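/- Let $d\in\mathbb N$, let $\mathscr P_c(\mathbb R^d)$ be the set of compactly supported Borel probability measures on $\mathbb R^d$, let $B_R$ be the closed Euclidean ball of radius $R$ centered at $0$, and let $\mathscr P(B_R)$ be the set of Borel probability measures on $\mathbb R^d$ supported on $B_R$. Let $W_2$ be the 2-Wasserstein distance, \[W_2^2(\alpha,\mu)=\inf_{\gamma\in\Pi(\alpha,\mu)}\int_{\mathbb R^d\times\mathbb R^d}|x-y|^2\,\gamma(\mathrm dx,\mathrm dy),\] where $\Pi(\alpha,\mu)$ is the set of Borel probability measures on $\mathbb R^d\times\mathbb R^d$ with marginals $\alpha$ and $\mu$. Let $B:\alpha\in\mathscr P_c(\mathbb R^d)\mapsto B[\alpha]\in C(\mathbb R^d,\mathbb R^d)$ satisfy: (H1) $C>0$ is a constant such that $|B[\alpha](x)|\le C(1+|x|)$ for all $(x,\alpha)\in\mathbb R^d\times\mathscr P_c(\mathbb R^d)$; (H2) for every $R>0$ the Lipschitz constants on $B_R$ of the maps $B[\alpha]$, $\alpha\in\mathscr P(B_R)$, are bounded uniformly in $\alpha$; (H3) for every $R>0$ there is a constant $M_R<+\infty$ with $\|B[\alpha^1]-B[\alpha^2]\|_{L^\infty(B_R)}\le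 M_R\,W_2(\alpha^1,\alpha^2)$ for all $\alpha^1,\alpha^2\in\mathscr P(B_R)$. Let $R_0>0$, $\alpha_0\in\mathscr P(B_{R_0})$, $T>0$, and set $R_T:=(R_0+1)e^{CT}$. Then there exists a unique curve $t\in[0,T]\mapsto\alpha_t\in\mathscr P(B_{R_T})$ which is a weak solution on $[0,T]\times\mathbb R^d$ of \[\partial_t\alpha+\mathrm{div}(\alpha B[\alpha])=0,\qquad \alpha(0,\cdot)=\alpha_0,\] that is, which is continuous for $W_2$, equals $\alpha_0$ at $t=0$, and satisfies, for every $f\in C^1([0,T]\times\mathbb R^d)$, \[\int_0^T\int_{\mathbb R^d}\bigl[\partial_t f(t,x)+B[\alpha_t](x)\cdot\nabla f(t,x)\bigr]\alpha_t(\mathrm dx)\,\mathrm dt=\int_{\mathbb R^d}f(T,x)\,\alpha_T(\mathrm dx)-\int_{\mathbb R^d}f(0,x)\,\alpha_0(\mathrm dx).\] -/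

import Mathlib

open MeasureTheory Set Filter Topology

/-- Compactly supported Borel probability measures on `ℝ^d`. -/
abbrev CompProb (d : ℕ) : Type :=
  {μ : ProbabilityMeasure (EuclideanSpace ℝ (Fin d)) //
    ∃ K : Set (EuclideanSpace ℝ (Fin d)), IsCompact K ∧
      (μ : Measure (EuclideanSpace ℝ (Fin d))) Kᶜ = 0}

/-- The Borel measure underlying a compactly supported probability measure. -/
def CompProb.toMeasure {d : ℕ} (μ : CompProb d) : Measure (EuclideanSpace ℝ (Fin d)) :=
  (μ.1 : Measure (EuclideanSpace ℝ (Fin d)))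

/-- The set of compactly supported probability measures that are supported on the closed
Euclidean ball of radius `R` centered at `0`. -/
def probBall (d : ℕ) (R : ℝ) : Set (CompProb d) :=
  {μ | μ.toMeasure (Metric.closedBall 0 R)ᶜ = 0}

/-- Transport plans: Borel measures on `ℝ^d × ℝ^d` with marginals `μ` and `ν` (they are
automatically probability measures, since `μ` is). -/
def transportPlans {d : ℕ} (μ ν : CompProb d) :
    Set (Measure (EuclideanSpace ℝ (Fin d) × EuclideanSpace ℝ (Fin d))) :=
  {γ | γ.map Prod.fst = μ.toMeasure ∧ γ.map Prod.snd = ν.toMeasure}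

/-- The 2-Wasserstein distance, the square root of the infimum of the quadratic transport cost.
For compactly supported `μ` and `ν` there is a plan, and every plan has a finite cost. -/
noncomputable def W2 {d : ℕ} (μ ν : CompProb d) : ℝ :=
  Real.sqrt (sInf ((fun γ : Measure (EuclideanSpace ℝ (Fin d) × EuclideanSpace ℝ (Fin d)) =>
    ∫ p, ‖p.1 - p.2‖ ^ 2 ∂γ) '' transportPlans μ ν))

/-- Linear growth: `|B[α](x)| ≤ C (1 + |x|)` for all `x` and `α`. -/
def LinearGrowth {d : ℕ}
    (B : CompProb d → C(EuclideanSpace ℝ (Fin d), EuclideanSpace ℝ (Fin d))) (C : ℝ) : Prop :=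
  ∀ (α : CompProb d) (x : EuclideanSpace ℝ (Fin d)), ‖B α x‖ ≤ C * (1 + ‖x‖)

/-- For every `R > 0`, the Lipschitz constants on `B_R` of the fields `B[α]`, `α ∈ P(B_R)`,
are bounded. -/
def LipschitzInSpace {d : ℕ}
    (B : CompProb d → C(EuclideanSpace ℝ (Fin d), EuclideanSpace ℝ (Fin d))) : Prop :=
  ∀ R : ℝ, 0 < R → ∃ K : NNReal, ∀ α ∈ probBall d R,
    LipschitzOnWith K (B α) (Metric.closedBall 0 R)

/-- For every `R > 0`, the map `α ↦ B[α]` is Lipschitz from `(P(B_R), W₂)` to `L^∞(B_R)`.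
The fields are continuous, so the `L^∞(B_R)` norm is the supremum over `B_R`. -/
def LipschitzInMeasure {d : ℕ}
    (B : CompProb d → C(EuclideanSpace ℝ (Fin d), EuclideanSpace ℝ (Fin d))) : Prop :=
  ∀ R : ℝ, 0 < R → ∃ M : ℝ, ∀ α₁ ∈ probBall d R, ∀ α₂ ∈ probBall d R,
    ∀ x ∈ Metric.closedBall (0 : EuclideanSpace ℝ (Fin d)) R,
      ‖B α₁ x - B α₂ x‖ ≤ M * W2 α₁ α₂

/-- `W₂`-continuity of a curve of compactly supported probability measures on `[0,T]`. -/
def W2Continuous {d : ℕ} {T : ℝ} (α : Icc (0 : ℝ) T → CompProb d) : Prop :=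
  ∀ t₀ : Icc (0 : ℝ) T, Tendsto (fun t => W2 (α t) (α t₀)) (𝓝 t₀) (𝓝 0)

/-- `α` is a weak solution on `[0,T] × ℝ^d` of `∂ₜα + div(α B[α]) = 0`, `α(0,·) = α₀`:
it is `W₂`-continuous, it starts at `α₀`, and for every `f ∈ C¹([0,T] × ℝ^d)`
`∫₀ᵀ ∫ (∂ₜf + B[αₜ]·∇f) dαₜ dt = ∫ f(T,·) dα_T - ∫ f(0,·) dα₀`.
On the range of integration `projIcc 0 T hT t` is `t` seen as a point of `[0,T]`. -/
structure IsWeakSolution {d : ℕ}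
    (B : CompProb d → C(EuclideanSpace ℝ (Fin d), EuclideanSpace ℝ (Fin d)))
    {T : ℝ} (hT : 0 ≤ T) (α₀ : CompProb d) (α : Icc (0 : ℝ) T → CompProb d) : Prop where
  continuous : W2Continuous α
  initial : α ⟨0, left_mem_Icc.2 hT⟩ = α₀
  weak : ∀ f : ℝ × EuclideanSpace ℝ (Fin d) → ℝ,
    ContDiffOn ℝ 1 f (Icc (0 : ℝ) T ×ˢ univ) →
    ∫ t in (0 : ℝ)..T, ∫ x, (derivWithin (fun s => f (s, x)) (Icc (0 : ℝ) T) t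
        + inner ℝ (B (α (projIcc 0 T hT t)) x) (gradient (fun y => f (t, y)) x))
          ∂(α (projIcc 0 T hT t)).toMeasure
      = ∫ x, f (T, x) ∂(α ⟨T, right_mem_Icc.2 hT⟩).toMeasure - ∫ x, f (0, x) ∂α₀.toMeasure

/-! The equation is solved in Lagrangian form. Put `R = (R₀ + 1) e^{CT}` and precompose every field
with the radial retraction onto `B_R`, which makes it bounded and globally Lipschitz. A bounded
continuous map `X` transports `α₀` to `X#α₀`, and `X ↦ B[X#α₀] ∘ X`, with retractions inserted, is a
vector field on the Banach space of bounded continuous maps (`lagrangianField`). It is globally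
Lipschitz by (H2) and (H3), since the coupling `(X, Y)` gives `W₂(X#α₀, Y#α₀) ≤ ‖X - Y‖_∞`.
Picard-Lindelöf gives a curve `X_t`. Linear growth and Grönwall keep its values in `B_R`, so the
retractions never act, and the chain rule along trajectories makes `X_t#α₀` a weak solution.

For uniqueness, a solution `α` is frozen inside the field: `b_t = B[α_t]`. The flow `Y` of `b`
transports `α₀` to a solution of the same linear equation, so linear uniqueness
(`SolvesContinuityEquation.eq_of_zero_eq`) gives `α_t = Y_t#α₀`. Hence `Y` is an integral curve of
the field on bounded maps, and `Y = X`.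

Linear uniqueness is a duality argument. The exact flow of a Lipschitz field need not preserve `C¹`
test functions, so these are pulled back by Euler steps along smoothed fields. The error of a step
is small compared with its length, uniformly over solutions, and vanishes as the steps are refined.
-/

open scoped BoundedContinuousFunction

/-! ### Radial retraction onto a ball -/

/-- The radial retraction of a normed space onto the closed ball of radius `R` around `0`. -/
noncomputable def ballRetract {V : Type*} [NormedAddCommGroup V] [NormedSpace ℝ V] (R : ℝ)
    (x : V) : V :=
  (R / max R ‖x‖) • x

section BallRetract

variable {V : Type*} [NormedAddCommGroup V] [NormedSpace ℝ V] {R : ℝ}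

theorem ballRetract_of_norm_le (hR : 0 < R) {x : V} (hx : ‖x‖ ≤ R) : ballRetract R x = x := by
  rw [ballRetract, max_eq_left hx, div_self hR.ne', one_smul]

theorem norm_ballRetract_le (hR : 0 < R) (x : V) : ‖ballRetract R x‖ ≤ R := by
  have h : 0 < max R ‖x‖ := lt_max_of_lt_left hR
  rw [ballRetract, norm_smul, Real.norm_of_nonneg (by positivity), div_mul_eq_mul_div,
    div_le_iff₀ h]
  exact mul_le_mul_of_nonneg_left (le_max_right _ _) hR.le

theorem norm_ballRetract_le_norm (hR : 0 < R) (x : V) : ‖ballRetract R x‖ ≤ ‖x‖ := by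
  have h : 0 < max R ‖x‖ := lt_max_of_lt_left hR
  rw [ballRetract, norm_smul, Real.norm_of_nonneg (by positivity)]
  exact mul_le_of_le_one_left (norm_nonneg x) ((div_le_one h).2 (le_max_left _ _))

/-- Moving the point at a fixed scaling factor and changing the factor at a fixed point each cost at
most `‖x - y‖`. -/
theorem lipschitzWith_ballRetract (hR : 0 < R) :
    LipschitzWith 2 (ballRetract R : V → V) := by
  refine LipschitzWith.of_dist_le_mul fun x y => ?_
  rw [dist_eq_norm, dist_eq_norm]
  have hx : 0 < max R ‖x‖ := lt_max_of_lt_left hR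
  have hy : 0 < max R ‖y‖ := lt_max_of_lt_left hR
  have e : ballRetract R x - ballRetract R y
      = (R / max R ‖x‖) • (x - y) + (R / max R ‖x‖ - R / max R ‖y‖) • y := by
    simp only [ballRetract]; module
  have h1 : ‖(R / max R ‖x‖) • (x - y)‖ ≤ ‖x - y‖ := by
    rw [norm_smul, Real.norm_of_nonneg (by positivity)]
    exact mul_le_of_le_one_left (norm_nonneg _) ((div_le_one hx).2 (le_max_left _ _))
  have h2 : ‖(R / max R ‖x‖ - R / max R ‖y‖) • y‖ ≤ ‖x - y‖ := by
    have e2 : R / max R ‖x‖ - R / max R ‖y‖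
        = (R / max R ‖x‖) * ((max R ‖y‖ - max R ‖x‖) / max R ‖y‖) := by
      field_simp
    have h3 : |max R ‖y‖ - max R ‖x‖| ≤ ‖x - y‖ := by
      refine (abs_max_sub_max_le_max R ‖y‖ R ‖x‖).trans ?_
      rw [sub_self, abs_zero, max_eq_right (abs_nonneg _), norm_sub_rev]
      exact abs_norm_sub_norm_le y x
    rw [e2, norm_smul, norm_mul, Real.norm_of_nonneg (by positivity : 0 ≤ R / max R ‖x‖),
      norm_div, Real.norm_eq_abs, Real.norm_of_nonneg hy.le, mul_assoc]
    calc R / max R ‖x‖ * (|max R ‖y‖ - max R ‖x‖| / max R ‖y‖ * ‖y‖)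
        ≤ 1 * (|max R ‖y‖ - max R ‖x‖| / max R ‖y‖ * ‖y‖) := by
          gcongr
          exact (div_le_one hx).2 (le_max_left _ _)
      _ = |max R ‖y‖ - max R ‖x‖| * (‖y‖ / max R ‖y‖) := by ring
      _ ≤ |max R ‖y‖ - max R ‖x‖| * 1 := by
          gcongr
          exact (div_le_one hy).2 (le_max_right _ _)
      _ ≤ ‖x - y‖ := by rw [mul_one]; exact h3
  rw [e]
  refine (norm_add_le _ _).trans ?_
  push_cast
  linarith

theorem continuous_ballRetract (hR : 0 < R) : Continuous (ballRetract R : V → V) :=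
  (lipschitzWith_ballRetract hR).continuous

end BallRetract

/-! ### Mollification and ordinary differential equations -/

/-- A Lipschitz map of finite-dimensional spaces is uniformly approximated by `C¹` maps with the
same Lipschitz constant. -/
theorem LipschitzWith.exists_contDiff_lipschitzWith_norm_sub_le {V W : Type*}
    [NormedAddCommGroup V] [NormedSpace ℝ V] [FiniteDimensional ℝ V] [MeasurableSpace V]
    [BorelSpace V] [NormedAddCommGroup W] [NormedSpace ℝ W] [CompleteSpace W]
    {g : V → W} {K : NNReal} (hg : LipschitzWith K g) {ε : ℝ} (hε : 0 < ε) :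
    ∃ v : V → W, ContDiff ℝ 1 v ∧ LipschitzWith K v ∧ ∀ x, ‖v x - g x‖ ≤ ε := by
  -- Averaging `g` over a ball of radius `δ` moves it by at most `K * δ`. Since the kernel is
  -- nonnegative of mass one, averaging translates of `g` keeps the constant `K`.
  obtain ⟨δ, hδ, hδε⟩ : ∃ δ : ℝ, 0 < δ ∧ K * δ ≤ ε := by
    refine ⟨ε / (K + 1), by positivity, ?_⟩
    rw [mul_div_assoc', div_le_iff₀ (by positivity)]
    nlinarith [K.coe_nonneg]
  let φ : ContDiffBump (0 : V) := ⟨δ / 2, δ, by positivity, by linarith⟩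
  let μ : Measure V := Measure.addHaar
  have hcc : HasCompactSupport (φ.normed μ) := φ.hasCompactSupport_normed
  have hint : ∀ x, Integrable (fun t => φ.normed μ t • g (x - t)) μ := fun x =>
    (hcc.convolutionExists_left (ContinuousLinearMap.lsmul ℝ ℝ)
      φ.continuous_normed hg.continuous.locallyIntegrable x)
  refine ⟨MeasureTheory.convolution (φ.normed μ) g (ContinuousLinearMap.lsmul ℝ ℝ) μ,
    ?_, ?_, ?_⟩
  · exact hcc.contDiff_convolution_left _ φ.contDiff_normed hg.continuous.locallyIntegrable
  · refine LipschitzWith.of_dist_le_mul fun x y => ?_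
    simp only [MeasureTheory.convolution, ContinuousLinearMap.lsmul_apply]
    rw [dist_eq_norm, ← integral_sub (hint x) (hint y)]
    have hb : ∀ t, ‖φ.normed μ t • g (x - t) - φ.normed μ t • g (y - t)‖
        ≤ φ.normed μ t * (K * dist x y) := by
      intro t
      rw [← smul_sub, norm_smul, Real.norm_of_nonneg (φ.nonneg_normed t)]
      gcongr
      · exact φ.nonneg_normed t
      · rw [← dist_eq_norm]
        refine (hg.dist_le_mul _ _).trans ?_
        rw [dist_sub_right]
    refine (norm_integral_le_of_norm_le
      (((φ.continuous_normed.integrable_of_hasCompactSupport hcc).mul_const _))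
      (Eventually.of_forall hb)).trans ?_
    rw [integral_mul_const, φ.integral_normed, one_mul]
  · intro x
    rw [← dist_eq_norm]
    refine φ.dist_normed_convolution_le hg.continuous.aestronglyMeasurable fun y hy => ?_
    refine (hg.dist_le_mul _ _).trans (le_trans ?_ hδε)
    gcongr
    exact (Metric.mem_ball.1 hy).le

/-- Global existence for a bounded, globally Lipschitz time-dependent vector field. -/
theorem exists_hasDerivWithinAt_Icc_of_lipschitzWith {V : Type*} [NormedAddCommGroup V]
    [NormedSpace ℝ V] [CompleteSpace V] {F : ℝ → V → V} {K L : NNReal} {T : ℝ} (hT : 0 ≤ T)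
    (hlip : ∀ t, LipschitzWith K (F t)) (hcont : ∀ x, Continuous fun t => F t x)
    (hbd : ∀ t x, ‖F t x‖ ≤ L) (x₀ : V) :
    ∃ X : ℝ → V, X 0 = x₀ ∧ ∀ t ∈ Icc 0 T, HasDerivWithinAt X (F t (X t)) (Icc 0 T) t := by
  -- Speed at most `L` confines the curve to radius `L * T` up to time `T`. As the bounds are
  -- global, this radius is allowed and `T` need not be small.
  have h : IsPicardLindelof F (⟨0, left_mem_Icc.2 hT⟩ : Icc (0 : ℝ) T) x₀
      (L * ⟨T, hT⟩) 0 L K :=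
    { lipschitzOnWith := fun t _ => (hlip t).lipschitzOnWith
      continuousOn := fun x _ => (hcont x).continuousOn
      norm_le := fun t _ x _ => hbd t x
      mul_max_le := by
        simp only [sub_zero, sub_self, NNReal.coe_zero, max_eq_left hT]
        exact le_rfl }
  exact h.exists_eq_forall_mem_Icc_hasDerivWithinAt₀

/-- Two solutions of an ODE with a globally Lipschitz vector field that start at the same point
agree. -/
theorem eqOn_Icc_of_hasDerivWithinAt_of_lipschitzWith {V : Type*} [NormedAddCommGroup V]
    [NormedSpace ℝ V] {F : ℝ → V → V} {K : NNReal} {T : ℝ}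
    (hlip : ∀ t, LipschitzWith K (F t)) {X Y : ℝ → V}
    (hX : ∀ t ∈ Icc 0 T, HasDerivWithinAt X (F t (X t)) (Icc 0 T) t)
    (hY : ∀ t ∈ Icc 0 T, HasDerivWithinAt Y (F t (Y t)) (Icc 0 T) t) (h0 : X 0 = Y 0) :
    EqOn X Y (Icc 0 T) := by
  have key : ∀ {Z : ℝ → V}, (∀ t ∈ Icc 0 T, HasDerivWithinAt Z (F t (Z t)) (Icc 0 T) t) →
      ∀ t ∈ Ico 0 T, HasDerivWithinAt Z (F t (Z t)) (Ici t) t := fun hZ t ht =>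
    (hZ t (Ico_subset_Icc_self ht)).mono_of_mem_nhdsWithin (Icc_mem_nhdsGE_of_mem ht)
  intro t ht
  have := dist_le_of_trajectories_ODE hlip (fun t ht => (hX t ht).continuousWithinAt) (key hX)
    (fun t ht => (hY t ht).continuousWithinAt) (key hY) (dist_le_zero.2 h0) t ht
  rw [zero_mul] at this
  exact dist_le_zero.1 this

/-- The norm of a solution of an ODE of linear growth grows at most exponentially. -/
theorem norm_le_of_norm_deriv_le_mul_one_add {V : Type*} [NormedAddCommGroup V] [NormedSpace ℝ V]
    {C T r : ℝ} (hC : 0 < C) {y y' : ℝ → V}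
    (hy : ∀ t ∈ Icc 0 T, HasDerivWithinAt y (y' t) (Icc 0 T) t)
    (hb : ∀ t ∈ Icc 0 T, ‖y' t‖ ≤ C * (1 + ‖y t‖)) (h0 : ‖y 0‖ ≤ r) :
    ∀ t ∈ Icc 0 T, ‖y t‖ ≤ (r + 1) * Real.exp (C * T) := by
  intro t ht
  -- With both Grönwall constants equal to `C` the bound is `(r + 1) e^{Ct} - 1`.
  have := norm_le_gronwallBound_of_norm_deriv_right_le (δ := r) (K := C) (ε := C)
    (fun t ht => (hy t ht).continuousWithinAt)
    (fun t ht => (hy t (Ico_subset_Icc_self ht)).mono_of_mem_nhdsWithin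
      (Icc_mem_nhdsGE_of_mem ht)) h0
    (fun t ht => (hb t (Ico_subset_Icc_self ht)).trans_eq (by ring)) t ht
  rw [gronwallBound_of_K_ne_0 hC.ne', div_self hC.ne', sub_zero] at this
  simp only [one_mul] at this
  have hr : 0 ≤ r := (norm_nonneg _).trans h0
  have h2 : Real.exp (C * t) ≤ Real.exp (C * T) :=
    Real.exp_le_exp.2 (mul_le_mul_of_nonneg_left ht.2 hC.le)
  nlinarith [Real.exp_pos (C * t)]

/-! ### Push-forwards of compactly supported measures -/

namespace CompProb

variable {d : ℕ}

instance isProbabilityMeasure_toMeasure (μ : CompProb d) : IsProbabilityMeasure μ.toMeasure :=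
  inferInstanceAs (IsProbabilityMeasure (μ.1 : Measure (EuclideanSpace ℝ (Fin d))))

theorem toMeasure_injective : Function.Injective (toMeasure (d := d)) := fun _ _ h =>
  Subtype.ext (Subtype.ext h)

/-- The image of a compactly supported probability measure under a bounded continuous map. -/
noncomputable def map (μ : CompProb d)
    (X : EuclideanSpace ℝ (Fin d) →ᵇ EuclideanSpace ℝ (Fin d)) : CompProb d :=
  ⟨⟨μ.toMeasure.map X,
      Measure.isProbabilityMeasure_map X.continuous.measurable.aemeasurable⟩,
    Metric.closedBall 0 ‖X‖, isCompact_closedBall _ _, by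
      rw [ProbabilityMeasure.coe_mk, Measure.map_apply X.continuous.measurable
        Metric.isClosed_closedBall.measurableSet.compl]
      convert! measure_empty (μ := μ.toMeasure)
      ext x
      simp [X.norm_coe_le_norm x]⟩

variable {X : EuclideanSpace ℝ (Fin d) →ᵇ EuclideanSpace ℝ (Fin d)} {μ : CompProb d} {R : ℝ}

theorem toMeasure_map : (μ.map X).toMeasure = μ.toMeasure.map X := rfl

theorem mem_probBall_iff : μ ∈ probBall d R ↔ ∀ᵐ x ∂μ.toMeasure, ‖x‖ ≤ R := by
  rw [ae_iff]
  simp only [probBall, mem_ofPred_eq]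
  congr! 2
  ext x
  simp

theorem map_mem_probBall (h : ∀ᵐ x ∂μ.toMeasure, ‖X x‖ ≤ R) : μ.map X ∈ probBall d R := by
  rw [mem_probBall_iff, toMeasure_map]
  exact (ae_map_iff X.continuous.measurable.aemeasurable
    (isClosed_le continuous_norm continuous_const).measurableSet).2 h

theorem map_eq_self (h : ∀ᵐ x ∂μ.toMeasure, X x = x) : μ.map X = μ := by
  apply toMeasure_injective
  rw [toMeasure_map, Measure.map_congr h]
  exact Measure.map_id

theorem integral_map {G : Type*} [NormedAddCommGroup G] [NormedSpace ℝ G]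
    {f : EuclideanSpace ℝ (Fin d) → G} (hf : Continuous f) :
    ∫ x, f x ∂(μ.map X).toMeasure = ∫ x, f (X x) ∂μ.toMeasure := by
  rw [toMeasure_map]
  exact MeasureTheory.integral_map X.continuous.measurable.aemeasurable
    hf.aestronglyMeasurable

end CompProb

/-! ### Wasserstein distance and convergence of integrals -/

section Wasserstein

variable {d : ℕ}

theorem W2_nonneg (μ ν : CompProb d) : 0 ≤ W2 μ ν := Real.sqrt_nonneg _

theorem W2_le_of_mem_transportPlans {μ ν : CompProb d}
    {γ : Measure (EuclideanSpace ℝ (Fin d) × EuclideanSpace ℝ (Fin d))}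
    (hγ : γ ∈ transportPlans μ ν) : W2 μ ν ≤ √(∫ p, ‖p.1 - p.2‖ ^ 2 ∂γ) := by
  refine Real.sqrt_le_sqrt (csInf_le ⟨0, ?_⟩ ⟨γ, hγ, rfl⟩)
  rintro _ ⟨γ, -, rfl⟩
  exact integral_nonneg fun p => by positivity

/-- The image of `μ` under `x ↦ (X x, Y x)` is a plan whose cost is at most the squared sup
distance. This turns `W₂`-Lipschitz dependence into Lipschitz dependence on the transport map. -/
theorem W2_map_le_dist (μ : CompProb d)
    (X Y : EuclideanSpace ℝ (Fin d) →ᵇ EuclideanSpace ℝ (Fin d)) :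
    W2 (μ.map X) (μ.map Y) ≤ dist X Y := by
  have hm : Measurable fun x => (X x, Y x) :=
    X.continuous.measurable.prodMk Y.continuous.measurable
  refine (W2_le_of_mem_transportPlans (γ := μ.toMeasure.map fun x => (X x, Y x))
    ⟨?_, ?_⟩).trans ?_
  · rw [Measure.map_map measurable_fst hm]; rfl
  · rw [Measure.map_map measurable_snd hm]; rfl
  · rw [MeasureTheory.integral_map hm.aemeasurable (by fun_prop)]
    refine Real.sqrt_le_iff.2 ⟨dist_nonneg, ?_⟩
    have h : ∀ x, ‖‖X x - Y x‖ ^ 2‖ ≤ dist X Y ^ 2 := fun x => by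
      rw [norm_pow, norm_norm, ← dist_eq_norm]
      exact pow_le_pow_left₀ dist_nonneg (BoundedContinuousFunction.dist_coe_le_dist x) 2
    refine (Real.le_norm_self _).trans ((norm_integral_le_of_norm_le_const
      (Eventually.of_forall h)).trans ?_)
    simp

theorem transportPlans_nonempty (μ ν : CompProb d) : (transportPlans μ ν).Nonempty := by
  refine ⟨μ.toMeasure.prod ν.toMeasure, ?_, ?_⟩
  · simp
  · simp

theorem exists_transportPlan_of_W2_lt {μ ν : CompProb d} {ε : ℝ} (h : W2 μ ν < ε) :
    ∃ γ ∈ transportPlans μ ν, ∫ p, ‖p.1 - p.2‖ ^ 2 ∂γ < ε ^ 2 := by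
  have hε : 0 < ε := (W2_nonneg _ _).trans_lt h
  obtain ⟨_, ⟨γ, hγ, rfl⟩, hlt⟩ := exists_lt_of_csInf_lt
    ((transportPlans_nonempty μ ν).image _) ((Real.sqrt_lt' hε).1 h)
  exact ⟨γ, hγ, hlt⟩

/-- A continuous function on a compact set has, up to any `ε`, a quadratic modulus of continuity. -/
theorem ContinuousOn.exists_norm_sub_le_add_mul_sq {V : Type*} [NormedAddCommGroup V] {s : Set V}
    (hs : IsCompact s) {f : V → ℝ} (hf : ContinuousOn f s) {ε : ℝ} (hε : 0 < ε) :
    ∃ A : ℝ, 0 ≤ A ∧ ∀ x ∈ s, ∀ y ∈ s, |f x - f y| ≤ ε + A * ‖x - y‖ ^ 2 := by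
  obtain ⟨M, hM⟩ := hs.exists_bound_of_continuousOn hf
  obtain ⟨δ, hδ, h⟩ := Metric.uniformContinuousOn_iff.1
    (hs.uniformContinuousOn_of_continuous hf) ε hε
  -- Uniform continuity handles pairs closer than `δ`; for the others the quadratic term alone
  -- exceeds the trivial bound `2 * |M|`.
  refine ⟨2 * |M| / δ ^ 2, by positivity, fun x hx y hy => ?_⟩
  by_cases hxy : dist x y < δ
  · have := h x hx y hy hxy
    rw [Real.dist_eq] at this
    have h2 : 0 ≤ 2 * |M| / δ ^ 2 * ‖x - y‖ ^ 2 := by positivity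
    linarith
  · rw [not_lt, dist_eq_norm] at hxy
    have h1 : |f x - f y| ≤ 2 * |M| := by
      have hx' := (hM x hx).trans (le_abs_self M)
      have hy' := (hM y hy).trans (le_abs_self M)
      refine (abs_sub _ _).trans ?_
      rw [Real.norm_eq_abs] at hx' hy'
      linarith
    have h2 : 2 * |M| ≤ 2 * |M| / δ ^ 2 * ‖x - y‖ ^ 2 := by
      rw [div_mul_eq_mul_div, le_div_iff₀ (by positivity)]
      gcongr
    linarith

/-- `W₂`-convergence of measures supported in a fixed ball implies convergence of the integrals of
continuous functions. -/
theorem tendsto_integral_of_tendsto_W2 {ι : Type*} {l : Filter ι} {R : ℝ} {μ : ι → CompProb d}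
    {ν : CompProb d} (hμ : ∀ i, μ i ∈ probBall d R) (hν : ν ∈ probBall d R)
    (h : Tendsto (fun i => W2 (μ i) ν) l (𝓝 0)) {f : EuclideanSpace ℝ (Fin d) → ℝ}
    (hf : Continuous f) :
    Tendsto (fun i => ∫ x, f x ∂(μ i).toMeasure) l (𝓝 (∫ x, f x ∂ν.toMeasure)) := by
  rw [Metric.tendsto_nhds]
  intro ε hε
  obtain ⟨A, hA, hfA⟩ := hf.continuousOn.exists_norm_sub_le_add_mul_sq
    (isCompact_closedBall (0 : EuclideanSpace ℝ (Fin d)) R) (half_pos hε)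
  obtain ⟨M, hM⟩ := (isCompact_closedBall (0 : EuclideanSpace ℝ (Fin d)) R).exists_bound_of_continuousOn
    hf.continuousOn
  obtain ⟨η, hη, hηε⟩ : ∃ η : ℝ, 0 < η ∧ A * η ^ 2 < ε / 2 := by
    refine ⟨√(ε / (2 * (A + 1))), by positivity, ?_⟩
    rw [Real.sq_sqrt (by positivity), mul_div_assoc', div_lt_div_iff₀ (by positivity) two_pos]
    nlinarith
  filter_upwards [(tendsto_order.1 h).2 η hη] with i hi
  -- The quadratic modulus of `f` is integrated against a plan of cost below `η ^ 2`.
  obtain ⟨γ, ⟨h1, h2⟩, hγ⟩ := exists_transportPlan_of_W2_lt hi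
  have hp : IsProbabilityMeasure γ := by
    constructor
    have : IsProbabilityMeasure (γ.map Prod.fst) := h1 ▸ inferInstance
    have h3 := this.measure_univ
    rwa [Measure.map_apply measurable_fst MeasurableSet.univ, preimage_univ] at h3
  have hms : MeasurableSet {x : EuclideanSpace ℝ (Fin d) | ‖x‖ ≤ R} :=
    (isClosed_le continuous_norm continuous_const).measurableSet
  have b1 : ∀ᵐ p ∂γ, ‖p.1‖ ≤ R := by
    have := CompProb.mem_probBall_iff.1 (hμ i)
    rw [← h1] at this
    exact (ae_map_iff measurable_fst.aemeasurable hms).1 this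
  have b2 : ∀ᵐ p ∂γ, ‖p.2‖ ≤ R := by
    have := CompProb.mem_probBall_iff.1 hν
    rw [← h2] at this
    exact (ae_map_iff measurable_snd.aemeasurable hms).1 this
  have i1 : Integrable (fun p : EuclideanSpace ℝ (Fin d) × EuclideanSpace ℝ (Fin d) => f p.1) γ :=
    Integrable.of_bound (by fun_prop) M (b1.mono fun p hp => hM _ (by simpa using hp))
  have i2 : Integrable (fun p : EuclideanSpace ℝ (Fin d) × EuclideanSpace ℝ (Fin d) => f p.2) γ :=
    Integrable.of_bound (by fun_prop) M (b2.mono fun p hp => hM _ (by simpa using hp))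
  have i3 : Integrable (fun p : EuclideanSpace ℝ (Fin d) × EuclideanSpace ℝ (Fin d) =>
      ‖p.1 - p.2‖ ^ 2) γ := by
    refine Integrable.of_bound (by fun_prop) ((R + R) ^ 2) ?_
    filter_upwards [b1, b2] with p h1 h2
    rw [norm_pow, norm_norm]
    gcongr
    exact (norm_sub_le _ _).trans (add_le_add h1 h2)
  rw [← h1, ← h2, MeasureTheory.integral_map measurable_fst.aemeasurable
    hf.aestronglyMeasurable, MeasureTheory.integral_map measurable_snd.aemeasurable
    hf.aestronglyMeasurable, dist_eq_norm, ← integral_sub i1 i2]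
  refine (norm_integral_le_of_norm_le (g := fun p => ε / 2 + A * ‖p.1 - p.2‖ ^ 2)
    ((integrable_const _).add (i3.const_mul A)) ?_).trans_lt ?_
  · filter_upwards [b1, b2] with p h1 h2
    exact hfA _ (by simpa using h1) _ (by simpa using h2)
  · rw [integral_add (integrable_const _) (i3.const_mul A), integral_const, integral_const_mul]
    simp only [probReal_univ, one_smul]
    have : A * ∫ p, ‖p.1 - p.2‖ ^ 2 ∂γ ≤ A * η ^ 2 := mul_le_mul_of_nonneg_left hγ.le hA
    linarith

/-- A curve of probability measures on a ball which is continuous for `W₂` gives continuous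
integrals of jointly continuous functions. -/
theorem continuous_integral_of_W2 {S : Type*} [TopologicalSpace S] {R : ℝ}
    {μ : S → CompProb d} (hμ : ∀ t, μ t ∈ probBall d R)
    (hc : ∀ t₀, Tendsto (fun t => W2 (μ t) (μ t₀)) (𝓝 t₀) (𝓝 0))
    {F : S × EuclideanSpace ℝ (Fin d) → ℝ} (hF : Continuous F) :
    Continuous fun t => ∫ x, F (t, x) ∂(μ t).toMeasure := by
  refine continuous_iff_continuousAt.2 fun t₀ => ?_
  have hint : ∀ t s, Integrable (fun x => F (t, x)) (μ s).toMeasure := fun t s => by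
    obtain ⟨M, hM⟩ := (isCompact_closedBall (0 : EuclideanSpace ℝ (Fin d)) R).exists_bound_of_continuousOn
      (f := fun x => F (t, x)) (by fun_prop)
    refine Integrable.of_bound (by fun_prop) M ?_
    filter_upwards [CompProb.mem_probBall_iff.1 (hμ s)] with x hx
    exact hM x (by simpa using hx)
  have h1 := tendsto_integral_of_tendsto_W2 hμ (hμ t₀) (hc t₀) (f := fun x => F (t₀, x))
    (by fun_prop)
  -- The change of integrand is uniformly small on the compact ball, where every `μ t` lives; the
  -- change of measure is `h1`.
  have h2 : Tendsto (fun t => ∫ x, F (t, x) ∂(μ t).toMeasure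
      - ∫ x, F (t₀, x) ∂(μ t).toMeasure) (𝓝 t₀) (𝓝 0) := by
    rw [Metric.tendsto_nhds]
    intro ε hε
    have hcpt := (isCompact_closedBall (0 : EuclideanSpace ℝ (Fin d)) R)
    have hu : ∀ᶠ t in 𝓝 t₀, ∀ x ∈ Metric.closedBall (0 : EuclideanSpace ℝ (Fin d)) R,
        dist (F (t, x)) (F (t₀, x)) < ε / 2 := by
      have ho : IsOpen {p : S × EuclideanSpace ℝ (Fin d) |
          dist (F p) (F (t₀, p.2)) < ε / 2} :=
        isOpen_lt (by fun_prop) continuous_const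
      refine hcpt.eventually_forall_of_forall_eventually fun x _ => ?_
      exact ho.mem_nhds (show dist (F (t₀, x)) (F (t₀, x)) < ε / 2 by
        rw [dist_self]; positivity)
    filter_upwards [hu] with t ht
    rw [← integral_sub (hint t t) (hint t₀ t), dist_zero_right]
    refine (norm_integral_le_of_norm_le_const (C := ε / 2) ?_).trans_lt ?_
    · filter_upwards [CompProb.mem_probBall_iff.1 (hμ t)] with x hx
      exact (ht x (by simpa using hx)).le
    · simpa using half_lt_self hε
  simpa [ContinuousAt] using h2.add h1

end Wasserstein

/-! ### Flows solve the continuity equation -/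

/-- Along a direction of the form `(1, v)`, the derivative within `[0,T] × V` of a `C¹` function
splits into the time derivative and the inner product of `v` with the space gradient. -/
theorem derivWithin_add_inner_gradient {V : Type*} [NormedAddCommGroup V] [InnerProductSpace ℝ V]
    [CompleteSpace V] {T : ℝ} (hT : 0 < T) {f : ℝ × V → ℝ}
    (hf : DifferentiableOn ℝ f (Icc (0 : ℝ) T ×ˢ univ)) {t : ℝ} (ht : t ∈ Icc 0 T) (x v : V) :
    derivWithin (fun s => f (s, x)) (Icc (0 : ℝ) T) t
        + inner ℝ v (gradient (fun y => f (t, y)) x)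
      = fderivWithin ℝ f (Icc (0 : ℝ) T ×ˢ univ) (t, x) (1, v) := by
  have hD := (hf (t, x) ⟨ht, mem_univ _⟩).hasFDerivWithinAt
  set D := fderivWithin ℝ f (Icc (0 : ℝ) T ×ˢ univ) (t, x)
  have h1 : HasDerivWithinAt (fun s => f (s, x)) (D (1, 0)) (Icc 0 T) t :=
    hD.comp_hasDerivWithinAt t
      ((hasDerivWithinAt_id t (Icc 0 T)).prodMk (hasDerivWithinAt_const t (Icc 0 T) x))
      (fun s hs => mk_mem_prod hs (mem_univ _))
  have h2 : HasFDerivAt (fun y => f (t, y)) (D.comp (ContinuousLinearMap.inr ℝ ℝ V)) x := by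
    rw [← hasFDerivWithinAt_univ]
    exact hD.comp x (hasFDerivAt_prodMk_right t x).hasFDerivWithinAt fun y _ => ⟨ht, mem_univ _⟩
  rw [h1.derivWithin (uniqueDiffOn_Icc hT t ht), h2.hasGradientAt.gradient, real_inner_comm,
    InnerProductSpace.toDual_symm_apply, ContinuousLinearMap.comp_apply,
    ContinuousLinearMap.inr_apply, ← map_add]
  simp


/-- The image of a measure under the flow of a continuous time-dependent vector field solves the
continuity equation. -/
theorem weak_formula_of_flow {d : ℕ} {T : ℝ} (hT : 0 < T) (μ : CompProb d)
    {b : ℝ → EuclideanSpace ℝ (Fin d) → EuclideanSpace ℝ (Fin d)}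
    (hb : Continuous fun p : ℝ × EuclideanSpace ℝ (Fin d) => b p.1 p.2)
    {X X' : ℝ → EuclideanSpace ℝ (Fin d) →ᵇ EuclideanSpace ℝ (Fin d)}
    (hX : ∀ t ∈ Icc 0 T, HasDerivWithinAt X (X' t) (Icc 0 T) t)
    (hX' : ∀ t ∈ Icc 0 T, ∀ x, X' t x = b t (X t x))
    {f : ℝ × EuclideanSpace ℝ (Fin d) → ℝ} (hf : ContDiffOn ℝ 1 f (Icc (0 : ℝ) T ×ˢ univ)) :
    ∫ t in (0 : ℝ)..T, ∫ x, fderivWithin ℝ f (Icc (0 : ℝ) T ×ˢ univ) (t, x) (1, b t x)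
          ∂(μ.map (X t)).toMeasure
      = ∫ x, f (T, x) ∂(μ.map (X T)).toMeasure - ∫ x, f (0, x) ∂(μ.map (X 0)).toMeasure := by
  set s : Set (ℝ × EuclideanSpace ℝ (Fin d)) := Icc (0 : ℝ) T ×ˢ univ
  have hsu : UniqueDiffOn ℝ s := (uniqueDiffOn_Icc hT).prod uniqueDiffOn_univ
  have hXc : ContinuousOn X (Icc 0 T) := fun t ht => (hX t ht).continuousWithinAt
  have hXp : Continuous fun t => X (projIcc 0 T hT.le t) :=
    hXc.comp_continuous (by fun_prop) fun t => (projIcc 0 T hT.le t).2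
  let k : ℝ × EuclideanSpace ℝ (Fin d) → ℝ := fun p => fderivWithin ℝ f s p (1, b p.1 p.2)
  have hk : ContinuousOn k s :=
    (hf.continuousOn_fderivWithin hsu le_rfl).clm_apply
      (continuousOn_const.prodMk hb.continuousOn)
  have hft : ∀ t ∈ Icc 0 T, Continuous fun x => f (t, x) := fun t ht =>
    hf.continuousOn.comp_continuous (by fun_prop) fun x => ⟨ht, mem_univ _⟩
  have hkt : ∀ t ∈ Icc 0 T, Continuous fun x => k (t, x) := fun t ht =>
    hk.comp_continuous (by fun_prop) fun x => ⟨ht, mem_univ _⟩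
  -- Clamping time to `[0,T]` makes the integrand continuous and bounded on all of `ℝ × ℝ^d`, as
  -- needed for Fubini and the fundamental theorem of calculus.
  let h : ℝ → EuclideanSpace ℝ (Fin d) → ℝ := fun t x =>
    k (projIcc 0 T hT.le t, X (projIcc 0 T hT.le t) x)
  have hev : Continuous fun p : ℝ × EuclideanSpace ℝ (Fin d) =>
      X (projIcc 0 T hT.le p.1) p.2 :=
    (hXp.comp continuous_fst).eval continuous_snd
  have hh : Continuous fun p : ℝ × EuclideanSpace ℝ (Fin d) => h p.1 p.2 :=
    hk.comp_continuous (f := fun p : ℝ × EuclideanSpace ℝ (Fin d) =>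
        ((projIcc 0 T hT.le p.1 : ℝ), X (projIcc 0 T hT.le p.1) p.2))
      ((continuous_subtype_val.comp (continuous_projIcc.comp continuous_fst)).prodMk hev)
      fun p => ⟨(projIcc 0 T hT.le p.1).2, mem_univ _⟩
  obtain ⟨ρ, hρ⟩ := isCompact_Icc.exists_bound_of_continuousOn hXc
  obtain ⟨M, hM⟩ := (isCompact_Icc.prod (isCompact_closedBall
    (0 : EuclideanSpace ℝ (Fin d)) ρ)).exists_bound_of_continuousOn
    (hk.mono (prod_mono_right (subset_univ _)))
  have hhM : ∀ t x, ‖h t x‖ ≤ M := fun t x =>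
    hM _ ⟨(projIcc 0 T hT.le t).2, mem_closedBall_zero_iff.2
      (((X _).norm_coe_le_norm x).trans (hρ _ (projIcc 0 T hT.le t).2))⟩
  have hproj : ∀ t ∈ Icc 0 T, (projIcc 0 T hT.le t : ℝ) = t := fun t ht => by
    rw [projIcc_of_mem hT.le ht]
  have e1 : ∫ t in (0 : ℝ)..T, ∫ x, k (t, x) ∂(μ.map (X t)).toMeasure
      = ∫ t in (0 : ℝ)..T, ∫ x, h t x ∂μ.toMeasure := by
    refine intervalIntegral.integral_congr fun t ht => ?_
    rw [uIcc_of_le hT.le] at ht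
    simp only [h, hproj t ht]
    exact CompProb.integral_map (hkt t ht)
  have e2 : ∀ x, ∫ t in (0 : ℝ)..T, h t x = f (T, X T x) - f (0, X 0 x) := fun x => by
    have hd : ∀ t ∈ Icc 0 T, HasDerivWithinAt (fun t => f (t, X t x)) (h t x) (Icc 0 T) t := by
      intro t ht
      have hXx : HasDerivWithinAt (fun t => X t x) (b t (X t x)) (Icc 0 T) t := by
        rw [← hX' t ht x]
        exact (BoundedContinuousFunction.evalCLM ℝ x).hasFDerivAt.comp_hasDerivWithinAt t (hX t ht)
      have hD := (hf.differentiableOn one_ne_zero (t, X t x) ⟨ht, mem_univ _⟩).hasFDerivWithinAt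
      simp only [h, k, hproj t ht]
      exact hD.comp_hasDerivWithinAt t ((hasDerivWithinAt_id t (Icc 0 T)).prodMk hXx)
        (fun r hr => mk_mem_prod hr (mem_univ _))
    refine intervalIntegral.integral_eq_sub_of_hasDerivAt_of_le hT.le
      (fun t ht => (hd t ht).continuousWithinAt)
      (fun t ht => (hd t (Ioo_subset_Icc_self ht)).hasDerivAt (Icc_mem_nhds ht.1 ht.2)) ?_
    exact (hh.comp (by fun_prop : Continuous fun t : ℝ => (t, x))).intervalIntegrable _ _
  have e3 : ∫ t in (0 : ℝ)..T, ∫ x, h t x ∂μ.toMeasure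
      = ∫ x, (∫ t in (0 : ℝ)..T, h t x) ∂μ.toMeasure := by
    simp only [intervalIntegral.integral_of_le hT.le]
    refine integral_integral_swap ?_
    exact Integrable.of_bound (f := Function.uncurry h) hh.aestronglyMeasurable M
      (Eventually.of_forall fun p => hhM p.1 p.2)
  have hi : ∀ t ∈ Icc 0 T, Integrable (fun x => f (t, X t x)) μ.toMeasure := fun t ht => by
    obtain ⟨A, hA⟩ := (isCompact_closedBall (0 : EuclideanSpace ℝ (Fin d))
      ρ).exists_bound_of_continuousOn (hft t ht).continuousOn
    exact Integrable.of_bound ((hft t ht).comp (X t).continuous).aestronglyMeasurable A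
      (Eventually.of_forall fun x => hA _ (mem_closedBall_zero_iff.2
        (((X _).norm_coe_le_norm x).trans (hρ _ ht))))
  have h0 := left_mem_Icc.2 hT.le
  have h1 := right_mem_Icc.2 hT.le
  change ∫ t in (0 : ℝ)..T, ∫ x, k (t, x) ∂(μ.map (X t)).toMeasure = _
  rw [e1, e3, CompProb.integral_map (hft T h1), CompProb.integral_map (hft 0 h0)]
  simp only [e2]
  exact integral_sub (hi T h1) (hi 0 h0)

/-! ### Uniqueness for the linear continuity equation -/

/-- A continuous curve `μ` of probability measures supported in the ball of radius `R` which solves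
the linear continuity equation `∂ₜμ + div (b μ) = 0` on `[0,T]`, tested against `C¹` functions. -/
structure SolvesContinuityEquation {d : ℕ} (R T : ℝ)
    (b : ℝ → EuclideanSpace ℝ (Fin d) → EuclideanSpace ℝ (Fin d)) (μ : ℝ → CompProb d) :
    Prop where
  mem_probBall : ∀ t, μ t ∈ probBall d R
  tendsto_W2 : ∀ t₀, Tendsto (fun t => W2 (μ t) (μ t₀)) (𝓝 t₀) (𝓝 0)
  weak : ∀ f : ℝ × EuclideanSpace ℝ (Fin d) → ℝ, ContDiff ℝ 1 f →
    ∫ t in (0 : ℝ)..T, ∫ x, fderiv ℝ f (t, x) (1, b t x) ∂(μ t).toMeasure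
      = ∫ x, f (T, x) ∂(μ T).toMeasure - ∫ x, f (0, x) ∂(μ 0).toMeasure

theorem CompProb.integrable_of_mem_probBall {d : ℕ} {R : ℝ} {μ : CompProb d}
    (hμ : μ ∈ probBall d R) {f : EuclideanSpace ℝ (Fin d) → ℝ} (hf : Continuous f) :
    Integrable f μ.toMeasure := by
  obtain ⟨M, hM⟩ := (isCompact_closedBall
    (0 : EuclideanSpace ℝ (Fin d)) R).exists_bound_of_continuousOn hf.continuousOn
  refine Integrable.of_bound hf.aestronglyMeasurable M ?_
  filter_upwards [CompProb.mem_probBall_iff.1 hμ] with x hx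
  exact hM x (by simpa using hx)

namespace SolvesContinuityEquation

variable {d : ℕ} {R T : ℝ} {b : ℝ → EuclideanSpace ℝ (Fin d) → EuclideanSpace ℝ (Fin d)}
  {μ ν : ℝ → CompProb d}

/-- The weak formulation holds on every interval `[0,t]` with `t ≤ T`. -/
theorem integral_sub_integral_zero (h : SolvesContinuityEquation R T b μ) (hT : 0 < T)
    (hb : Continuous fun p : ℝ × EuclideanSpace ℝ (Fin d) => b p.1 p.2)
    {f : ℝ × EuclideanSpace ℝ (Fin d) → ℝ} (hf : ContDiff ℝ 1 f) {t : ℝ} (ht : t ∈ Icc 0 T) :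
    ∫ x, f (t, x) ∂(μ t).toMeasure - ∫ x, f (0, x) ∂(μ 0).toMeasure
      = ∫ r in (0 : ℝ)..t, ∫ x, fderiv ℝ f (r, x) (1, b r x) ∂(μ r).toMeasure := by
  have hk : Continuous fun p : ℝ × EuclideanSpace ℝ (Fin d) =>
      fderiv ℝ f p (1, b p.1 p.2) :=
    (hf.continuous_fderiv one_ne_zero).clm_apply (continuous_const.prodMk hb)
  set G : ℝ → ℝ := fun t => ∫ x, f (t, x) ∂(μ t).toMeasure
  set g : ℝ → ℝ := fun r => ∫ x, fderiv ℝ f (r, x) (1, b r x) ∂(μ r).toMeasure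
  have hGc : Continuous G := continuous_integral_of_W2 h.mem_probBall h.tendsto_W2 hf.continuous
  have hgc : Continuous g := continuous_integral_of_W2 h.mem_probBall h.tendsto_W2 hk
  let P : ℝ → ℝ := fun t => ∫ r in (0 : ℝ)..t, g r
  have hP : ∀ t, HasDerivAt P (g t) t := fun t =>
    intervalIntegral.integral_hasDerivAt_right (hgc.intervalIntegrable _ _)
      (hgc.stronglyMeasurableAtFilter _ _) hgc.continuousAt
  have hPc : Continuous P := continuous_iff_continuousAt.2 fun t => (hP t).continuousAt
  let H : ℝ → ℝ := fun t => G t - P t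
  have hH : Continuous H := hGc.sub hPc
  -- The claim is that `H` is constant on `[0,T]`. Testing with `χ f`, where `χ' = H - c` and `χ 0 =
  -- 0`, and integrating `(χ P)'`, gives `∫ (H - c) H = χ(T) H(T)`. As `H(T) = c` and `χ(T) = ∫ (H -
  -- c)`, this reads `∫ (H - c)² = 0`.
  set c := H T
  let χ : ℝ → ℝ := fun t => ∫ r in (0 : ℝ)..t, (H r - c)
  have hHc : Continuous fun r => H r - c := by fun_prop
  have hχ : ∀ t, HasDerivAt χ (H t - c) t := fun t =>
    intervalIntegral.integral_hasDerivAt_right (hHc.intervalIntegrable _ _)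
      (hHc.stronglyMeasurableAtFilter _ _) hHc.continuousAt
  have hχc : Continuous χ := continuous_iff_continuousAt.2 fun t => (hχ t).continuousAt
  have hχ1 : ContDiff ℝ 1 χ := by
    rw [contDiff_one_iff_deriv]
    refine ⟨fun t => (hχ t).differentiableAt, ?_⟩
    rwa [show deriv χ = fun r => H r - c from funext fun t => (hχ t).deriv]
  have hχ0 : χ 0 = 0 := intervalIntegral.integral_same
  have hP0 : P 0 = 0 := intervalIntegral.integral_same
  have hw := h.weak (fun p => χ p.1 * f p) ((hχ1.comp contDiff_fst).mul hf)
  have hint : ∀ r, ∫ x, fderiv ℝ (fun p : ℝ × EuclideanSpace ℝ (Fin d) => χ p.1 * f p) (r, x)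
      (1, b r x) ∂(μ r).toMeasure = (H r - c) * G r + χ r * g r := by
    intro r
    have e : ∀ x, fderiv ℝ (fun p : ℝ × EuclideanSpace ℝ (Fin d) => χ p.1 * f p) (r, x)
        (1, b r x) = (H r - c) * f (r, x) + χ r * fderiv ℝ f (r, x) (1, b r x) := by
      intro x
      have h1 : HasFDerivAt (fun p : ℝ × EuclideanSpace ℝ (Fin d) => χ p.1)
          ((H r - c) • ContinuousLinearMap.fst ℝ ℝ (EuclideanSpace ℝ (Fin d))) (r, x) :=
        HasDerivAt.comp_hasFDerivAt (h₂ := χ) (f := Prod.fst) (r, x) (hχ r) hasFDerivAt_fst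
      have h2 := (hf.differentiable one_ne_zero (r, x)).hasFDerivAt
      rw [(h1.fun_mul h2).fderiv]
      simp only [add_apply, smul_apply,
        ContinuousLinearMap.coe_fst', smul_eq_mul]
      ring
    simp only [e]
    have i1 : Continuous fun x => f (r, x) := hf.continuous.comp (by fun_prop)
    have i2 : Continuous fun x => fderiv ℝ f (r, x) (1, b r x) :=
      hk.comp (by fun_prop : Continuous fun x => (r, x))
    rw [integral_add ((CompProb.integrable_of_mem_probBall (h.mem_probBall r) i1).const_mul _)
      ((CompProb.integrable_of_mem_probBall (h.mem_probBall r) i2).const_mul _),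
      integral_const_mul, integral_const_mul]
  simp only [hint, hχ0, zero_mul, integral_zero, sub_zero, integral_const_mul] at hw
  have hparts : ∫ r in (0 : ℝ)..T, ((H r - c) * P r + χ r * g r) = χ T * P T := by
    rw [intervalIntegral.integral_eq_sub_of_hasDerivAt (f := fun r => χ r * P r)
      (fun r _ => (hχ r).mul (hP r)) (Continuous.intervalIntegrable (by fun_prop) _ _),
      hχ0, zero_mul, sub_zero]
  have hsq : ∫ r in (0 : ℝ)..T, (H r - c) ^ 2 = 0 := by
    have e : ∀ r, (H r - c) ^ 2 = ((H r - c) * G r + χ r * g r)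
        - ((H r - c) * P r + χ r * g r) - c * (H r - c) := fun r => by simp only [H]; ring
    simp only [e]
    rw [intervalIntegral.integral_sub (Continuous.intervalIntegrable (by fun_prop) _ _)
      (Continuous.intervalIntegrable (by fun_prop) _ _),
      intervalIntegral.integral_sub (Continuous.intervalIntegrable (by fun_prop) _ _)
      (Continuous.intervalIntegrable (by fun_prop) _ _), hw, hparts,
      intervalIntegral.integral_const_mul]
    change χ T * G T - χ T * P T - (G T - P T) * χ T = 0
    ring
  have hconst : ∀ r ∈ Icc 0 T, H r = c := by
    intro r hr
    by_contra hne
    refine hsq.not_gt (intervalIntegral.integral_pos hT (by fun_prop)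
      (fun r _ => sq_nonneg _) ⟨r, hr, ?_⟩)
    have := sub_ne_zero.2 hne
    positivity
  have h1 : G t - P t = G 0 - P 0 := (hconst t ht).trans (hconst 0 (left_mem_Icc.2 hT.le)).symm
  rw [hP0, sub_zero] at h1
  change G t - G 0 = P t
  linarith

/-- The weak formulation holds on every subinterval of `[0,T]`. -/
theorem integral_sub_integral (h : SolvesContinuityEquation R T b μ) (hT : 0 < T)
    (hb : Continuous fun p : ℝ × EuclideanSpace ℝ (Fin d) => b p.1 p.2)
    {f : ℝ × EuclideanSpace ℝ (Fin d) → ℝ} (hf : ContDiff ℝ 1 f) {s t : ℝ} (hs : s ∈ Icc 0 T)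
    (ht : t ∈ Icc 0 T) :
    ∫ x, f (t, x) ∂(μ t).toMeasure - ∫ x, f (s, x) ∂(μ s).toMeasure
      = ∫ r in s..t, ∫ x, fderiv ℝ f (r, x) (1, b r x) ∂(μ r).toMeasure := by
  have hk : Continuous fun p : ℝ × EuclideanSpace ℝ (Fin d) =>
      fderiv ℝ f p (1, b p.1 p.2) :=
    (hf.continuous_fderiv one_ne_zero).clm_apply (continuous_const.prodMk hb)
  have hgc : Continuous fun r => ∫ x, fderiv ℝ f (r, x) (1, b r x) ∂(μ r).toMeasure :=
    continuous_integral_of_W2 h.mem_probBall h.tendsto_W2 hk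
  rw [← intervalIntegral.integral_interval_sub_left (hgc.intervalIntegrable 0 t)
    (hgc.intervalIntegrable 0 s), ← h.integral_sub_integral_zero hT hb hf ht,
    ← h.integral_sub_integral_zero hT hb hf hs]
  ring

/-- Over a short time interval, a solution is close to its image under an explicit Euler step. -/
theorem abs_integral_sub_integral_euler_le (h : SolvesContinuityEquation R T b μ) (hT : 0 < T)
    (hb : Continuous fun p : ℝ × EuclideanSpace ℝ (Fin d) => b p.1 p.2) {K Λ : NNReal} {M ε : ℝ}
    (hM : ∀ t x, ‖b t x‖ ≤ M) {s t : ℝ} (hs : s ∈ Icc 0 T) (ht : t ∈ Icc 0 T) (hst : s ≤ t)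
    {v : EuclideanSpace ℝ (Fin d) → EuclideanSpace ℝ (Fin d)} (hv : ContDiff ℝ 1 v)
    (hvK : LipschitzWith K v) (hvb : ∀ r ∈ Icc s t, ∀ x, ‖x‖ ≤ R → ‖b r x - v x‖ ≤ ε)
    {ψ : EuclideanSpace ℝ (Fin d) → ℝ} (hψ : ContDiff ℝ 1 ψ) (hψΛ : LipschitzWith Λ ψ) :
    |∫ x, ψ x ∂(μ t).toMeasure - ∫ x, ψ (x + (t - s) • v x) ∂(μ s).toMeasure|
      ≤ Λ * (ε + (t - s) * (K * M)) * (t - s) := by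
  -- This test function is `ψ` at time `t` and the Euler pullback of `ψ` at time `s`. Its derivative
  -- along `(1, b)` is `Dψ` applied to `b - v + (t - r) Dv b`, which is small.
  have hf : ContDiff ℝ 1 fun p : ℝ × EuclideanSpace ℝ (Fin d) =>
      ψ (p.2 + (t - p.1) • v p.2) :=
    hψ.comp (contDiff_snd.add ((contDiff_const.sub contDiff_fst).smul (hv.comp contDiff_snd)))
  have key := h.integral_sub_integral hT hb hf hs ht
  simp only [sub_self, zero_smul, add_zero] at key
  rw [key, ← Real.norm_eq_abs]
  refine (intervalIntegral.norm_integral_le_of_norm_le_const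
    (C := Λ * (ε + (t - s) * (K * M))) fun r hr => ?_).trans_eq ?_
  · rw [uIoc_of_le hst] at hr
    refine (norm_integral_le_of_norm_le_const (C := Λ * (ε + (t - s) * (K * M))) ?_).trans_eq
      (by simp)
    filter_upwards [CompProb.mem_probBall_iff.1 (h.mem_probBall r)] with x hx
    have hd1 : HasFDerivAt (fun p : ℝ × EuclideanSpace ℝ (Fin d) => v p.2)
        ((fderiv ℝ v x).comp (ContinuousLinearMap.snd ℝ ℝ (EuclideanSpace ℝ (Fin d)))) (r, x) :=
      ((hv.differentiable one_ne_zero x).hasFDerivAt).comp (r, x) hasFDerivAt_snd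
    have hd2 : HasFDerivAt (fun p : ℝ × EuclideanSpace ℝ (Fin d) => t - p.1)
        (-ContinuousLinearMap.fst ℝ ℝ (EuclideanSpace ℝ (Fin d))) (r, x) :=
      hasFDerivAt_fst.const_sub t
    have hd3 := (hasFDerivAt_snd (𝕜 := ℝ) (p := (r, x))).add (hd2.smul hd1)
    have hd := (((hψ.differentiable one_ne_zero (x + (t - r) • v x)).hasFDerivAt)).comp (r, x) hd3
    have he : fderiv ℝ (fun p : ℝ × EuclideanSpace ℝ (Fin d) =>
        ψ (p.2 + (t - p.1) • v p.2)) (r, x) (1, b r x)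
        = fderiv ℝ ψ (x + (t - r) • v x) (b r x - v x + (t - r) • fderiv ℝ v x (b r x)) := by
      refine (congrArg (fun L => L (1, b r x)) hd.fderiv).trans ?_
      simp only [ContinuousLinearMap.comp_apply, add_apply,
        smul_apply, ContinuousLinearMap.coe_snd',
        ContinuousLinearMap.smulRight_apply, neg_apply,
        ContinuousLinearMap.coe_fst', neg_smul, one_smul]
      congr 1
      abel
    rw [he]
    refine (ContinuousLinearMap.le_opNorm _ _).trans ?_
    have hM0 : 0 ≤ M := (norm_nonneg _).trans (hM r x)
    have hb1 : ‖(t - r) • fderiv ℝ v x (b r x)‖ ≤ (t - s) * (K * M) := by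
      rw [norm_smul, Real.norm_of_nonneg (by linarith [hr.2])]
      refine mul_le_mul (by linarith [hr.1]) ?_ (norm_nonneg _) (by linarith)
      exact (ContinuousLinearMap.le_opNorm _ _).trans
        (mul_le_mul (norm_fderiv_le_of_lipschitz ℝ hvK) (hM r x) (norm_nonneg _) K.2)
    exact mul_le_mul (norm_fderiv_le_of_lipschitz ℝ hψΛ)
      ((norm_add_le _ _).trans (add_le_add (hvb r ⟨hr.1.le, hr.2⟩ x hx) hb1))
      (norm_nonneg _) Λ.2
  · rw [abs_of_nonneg (sub_nonneg.2 hst)]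

/-- Backward propagation of test functions: up to a small error, uniform over all solutions, the
integral of a Lipschitz `C¹` function at time `t` is the integral of another one at time `s`. -/
theorem exists_backward_test_function (R : ℝ) (hT : 0 < T)
    (hb : Continuous fun p : ℝ × EuclideanSpace ℝ (Fin d) => b p.1 p.2) {K : NNReal} {M : ℝ}
    (hK : ∀ t, LipschitzWith K (b t)) (hM : ∀ t x, ‖b t x‖ ≤ M) {η : ℝ} (hη : 0 < η) :
    ∃ δ > 0, ∀ s ∈ Icc 0 T, ∀ t ∈ Icc 0 T, s ≤ t → t - s ≤ δ →
      ∀ (Λ : NNReal) (ψ : EuclideanSpace ℝ (Fin d) → ℝ), ContDiff ℝ 1 ψ → LipschitzWith Λ ψ →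
      ∃ ψ' : EuclideanSpace ℝ (Fin d) → ℝ, ContDiff ℝ 1 ψ' ∧
        LipschitzWith (Λ * (1 + Real.toNNReal (t - s) * K)) ψ' ∧
        ∀ μ : ℝ → CompProb d, SolvesContinuityEquation R T b μ →
          |∫ x, ψ x ∂(μ t).toMeasure - ∫ x, ψ' x ∂(μ s).toMeasure| ≤ Λ * η * (t - s) := by
  obtain ⟨δ₁, hδ₁, hu⟩ := Metric.uniformContinuousOn_iff.1
    (((isCompact_Icc (a := (0 : ℝ)) (b := T)).prod (isCompact_closedBall
      (0 : EuclideanSpace ℝ (Fin d)) R)).uniformContinuousOn_of_continuous hb.continuousOn)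
    (η / 3) (by positivity)
  have hM0 : 0 ≤ M := (norm_nonneg _).trans (hM 0 0)
  obtain ⟨δ₂, hδ₂, hδM⟩ : ∃ δ : ℝ, 0 < δ ∧ δ * (K * M) ≤ η / 3 := by
    refine ⟨η / 3 / (K * M + 1), by positivity, ?_⟩
    rw [div_mul_eq_mul_div, div_le_iff₀ (by positivity)]
    have : 0 < η / 3 := by positivity
    nlinarith
  -- Three errors of size `η / 3`: the variation of `b` in time (`δ₁`), the smoothing of `b s` into
  -- `v`, and the second-order Euler term (`δ₂`).
  refine ⟨min (δ₁ / 2) δ₂, by positivity, fun s hs t ht hst hd Λ ψ hψ hψΛ => ?_⟩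
  obtain ⟨v, hv, hvK, hvb⟩ := (hK s).exists_contDiff_lipschitzWith_norm_sub_le
    (show 0 < η / 3 by positivity)
  refine ⟨fun x => ψ (x + (t - s) • v x),
    hψ.comp (contDiff_id.add (hv.const_smul (t - s))), ?_, fun μ h => ?_⟩
  · refine hψΛ.comp (LipschitzWith.id.add ?_)
    refine LipschitzWith.of_dist_le_mul fun x y => ?_
    rw [dist_smul₀, Real.norm_of_nonneg (sub_nonneg.2 hst), NNReal.coe_mul,
      Real.coe_toNNReal _ (sub_nonneg.2 hst), mul_assoc]
    exact mul_le_mul_of_nonneg_left (hvK.dist_le_mul x y) (sub_nonneg.2 hst)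
  · refine (h.abs_integral_sub_integral_euler_le hT hb hM hs ht hst hv hvK (ε := η / 3 + η / 3)
      (fun r hr x hx => ?_) hψ hψΛ).trans ?_
    · have hr' : r ∈ Icc 0 T := ⟨hs.1.trans hr.1, hr.2.trans ht.2⟩
      have hx' : x ∈ Metric.closedBall (0 : EuclideanSpace ℝ (Fin d)) R := by simpa using hx
      have h1 : dist (b r x) (b s x) < η / 3 := by
        refine hu (r, x) ⟨hr', hx'⟩ (s, x) ⟨hs, hx'⟩ ?_
        rw [Prod.dist_eq, dist_self, Real.dist_eq, abs_of_nonneg (sub_nonneg.2 hr.1),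
          max_eq_left (sub_nonneg.2 hr.1)]
        have := hd.trans (min_le_left _ _)
        linarith [hr.2]
      rw [dist_eq_norm] at h1
      have h2 := hvb x
      rw [norm_sub_rev] at h2
      calc ‖b r x - v x‖ = ‖(b r x - b s x) + (b s x - v x)‖ := by rw [sub_add_sub_cancel]
        _ ≤ _ := (norm_add_le _ _).trans (add_le_add h1.le h2)
    · have h3 : (t - s) * (K * M) ≤ η / 3 :=
        (mul_le_mul_of_nonneg_right (hd.trans (min_le_right _ _)) (by positivity)).trans hδM
      have : 0 ≤ t - s := sub_nonneg.2 hst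
      gcongr
      linarith

/-- Backward Euler steps reduce the comparison at time `t` to time `0`, where the curves agree. The
test functions depend only on the field, so they serve both solutions. -/
theorem integral_eq_of_zero_eq (hμ : SolvesContinuityEquation R T b μ)
    (hν : SolvesContinuityEquation R T b ν) (hT : 0 < T)
    (hb : Continuous fun p : ℝ × EuclideanSpace ℝ (Fin d) => b p.1 p.2) {K : NNReal} {M : ℝ}
    (hK : ∀ t, LipschitzWith K (b t)) (hM : ∀ t x, ‖b t x‖ ≤ M) (h0 : μ 0 = ν 0) {t : ℝ}
    (ht : t ∈ Icc 0 T) {Λ : NNReal} {ψ : EuclideanSpace ℝ (Fin d) → ℝ} (hψ : ContDiff ℝ 1 ψ)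
    (hψΛ : LipschitzWith Λ ψ) :
    ∫ x, ψ x ∂(μ t).toMeasure = ∫ x, ψ x ∂(ν t).toMeasure := by
  have main : ∀ η > 0, |∫ x, ψ x ∂(μ t).toMeasure - ∫ x, ψ x ∂(ν t).toMeasure|
      ≤ Λ * Real.exp (K * t) * (2 * t) * η := by
    intro η hη
    obtain ⟨δ, hδ, hstep⟩ := exists_backward_test_function R hT hb hK hM hη
    obtain ⟨N, hN⟩ := exists_nat_gt (t / δ)
    have hN0 : (0 : ℝ) < N := (div_nonneg ht.1 hδ.le).trans_lt hN
    set r : ℝ := t / N with hr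
    have hr0 : 0 ≤ r := div_nonneg ht.1 hN0.le
    have hrδ : r ≤ δ := by
      rw [hr, div_le_iff₀ hN0, mul_comm]
      exact ((div_lt_iff₀ hδ).1 hN).le
    have hrN : N * r = t := by rw [hr]; field_simp
    -- Each step replaces `ψ` and multiplies `Λ` by `1 + r * K`, hence the quantification over both;
    -- the factor 2 counts one error for `μ` and one for `ν`.
    have ind : ∀ i : ℕ, i ≤ N → ∀ (Λ : NNReal) (ψ : EuclideanSpace ℝ (Fin d) → ℝ),
        ContDiff ℝ 1 ψ → LipschitzWith Λ ψ →
        |∫ x, ψ x ∂(μ (i * r)).toMeasure - ∫ x, ψ x ∂(ν (i * r)).toMeasure|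
          ≤ Λ * (1 + r * K) ^ i * i * (2 * η * r) := by
      intro i
      induction i with
      | zero => intro _ Λ ψ _ _; simp [h0]
      | succ i ih =>
        intro hi Λ ψ hψ hψΛ
        have hi' : ((i + 1 : ℕ) : ℝ) ≤ N := by exact_mod_cast hi
        push_cast at hi' ⊢
        have hs : (i : ℝ) * r ∈ Icc 0 T :=
          ⟨by positivity, le_trans (by nlinarith) (hrN.le.trans ht.2)⟩
        have ht' : ((i : ℝ) + 1) * r ∈ Icc 0 T :=
          ⟨by positivity, le_trans (by nlinarith) (hrN.le.trans ht.2)⟩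
        have hsub : ((i : ℝ) + 1) * r - i * r = r := by ring
        obtain ⟨ψ', hψ', hψL, hclose⟩ := hstep _ hs _ ht' (by linarith) (by linarith) Λ ψ hψ hψΛ
        rw [hsub] at hψL hclose
        have h1 := hclose μ hμ
        have h2 := hclose ν hν
        have h3 := ih (by omega) _ ψ' hψ' hψL
        rw [NNReal.coe_mul, NNReal.coe_add, NNReal.coe_mul, NNReal.coe_one,
          Real.coe_toNNReal _ hr0] at h3
        have h4 : (Λ : ℝ) * (2 * η * r) ≤ Λ * (1 + r * K) ^ (i + 1) * (2 * η * r) := by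
          have : (1 : ℝ) ≤ (1 + r * K) ^ (i + 1) :=
            one_le_pow₀ (by linarith [mul_nonneg hr0 K.coe_nonneg])
          have h5 : 0 ≤ (Λ : ℝ) * (2 * η * r) := by positivity
          nlinarith
        have h6 : (Λ : ℝ) * (1 + r * K) * (1 + r * K) ^ i * i * (2 * η * r)
            + Λ * (1 + r * K) ^ (i + 1) * (2 * η * r)
            = Λ * (1 + r * K) ^ (i + 1) * (i + 1) * (2 * η * r) := by ring
        rw [← h6]
        rw [abs_le] at h1 h2 h3 ⊢
        constructor <;> linarith [h1.1, h1.2, h2.1, h2.2, h3.1, h3.2]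
    have h1 := ind N le_rfl Λ ψ hψ hψΛ
    rw [hrN] at h1
    refine h1.trans ?_
    have h2 : (1 + r * K) ^ N ≤ Real.exp (K * t) := by
      have h3 : 1 + r * K ≤ Real.exp (r * K) := by
        rw [add_comm]; exact Real.add_one_le_exp _
      calc (1 + r * K) ^ N ≤ Real.exp (r * K) ^ N :=
            pow_le_pow_left₀ (by positivity) h3 N
        _ = Real.exp (K * t) := by
            rw [← Real.exp_nat_mul, ← hrN]; ring_nf
    have h4 : (Λ : ℝ) * (1 + r * K) ^ N * N * (2 * η * r)
        = Λ * (1 + r * K) ^ N * (2 * t) * η := by rw [← hrN]; ring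
    rw [h4]
    have := ht.1
    gcongr
  have h1 : |∫ x, ψ x ∂(μ t).toMeasure - ∫ x, ψ x ∂(ν t).toMeasure| ≤ 0 := by
    refine le_of_forall_pos_le_add fun ε hε => ?_
    have hA : 0 ≤ Λ * Real.exp (K * t) * (2 * t) := by have := ht.1; positivity
    refine (main (ε / (Λ * Real.exp (K * t) * (2 * t) + 1)) (by positivity)).trans ?_
    rw [zero_add, mul_div_assoc', div_le_iff₀ (by positivity)]
    nlinarith
  exact sub_eq_zero.1 (abs_nonpos_iff.1 h1)

/-- Uniqueness for the linear continuity equation with a bounded Lipschitz field. -/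
theorem eq_of_zero_eq (hμ : SolvesContinuityEquation R T b μ)
    (hν : SolvesContinuityEquation R T b ν) (hT : 0 < T)
    (hb : Continuous fun p : ℝ × EuclideanSpace ℝ (Fin d) => b p.1 p.2) {K : NNReal} {M : ℝ}
    (hK : ∀ t, LipschitzWith K (b t)) (hM : ∀ t x, ‖b t x‖ ≤ M) (h0 : μ 0 = ν 0) {t : ℝ}
    (ht : t ∈ Icc 0 T) : μ t = ν t := by
  apply CompProb.toMeasure_injective
  apply Measure.ext_of_charFun
  funext ξ
  -- The real and imaginary parts of the characteristic function are integrals of `C¹` Lipschitz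
  -- functions.
  have hlin : LipschitzWith ‖innerSL ℝ ξ‖₊ fun x : EuclideanSpace ℝ (Fin d) => inner ℝ ξ x :=
    (innerSL ℝ ξ).lipschitz
  have hsmooth : ContDiff ℝ 1 fun x : EuclideanSpace ℝ (Fin d) => inner ℝ ξ x :=
    (innerSL ℝ ξ).contDiff
  have hcos := hμ.integral_eq_of_zero_eq hν hT hb hK hM h0 ht
    (Real.contDiff_cos.comp hsmooth) (Real.lipschitzWith_cos.comp hlin)
  have hsin := hμ.integral_eq_of_zero_eq hν hT hb hK hM h0 ht
    (Real.contDiff_sin.comp hsmooth) (Real.lipschitzWith_sin.comp hlin)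
  have key : ∀ α : CompProb d, charFun α.toMeasure ξ
      = ((∫ x, Real.cos (inner ℝ ξ x) ∂α.toMeasure : ℝ) : ℂ)
        + ((∫ x, Real.sin (inner ℝ ξ x) ∂α.toMeasure : ℝ) : ℂ) * Complex.I := by
    intro α
    have ic : Integrable (fun x => Real.cos (inner ℝ ξ x)) α.toMeasure :=
      Integrable.of_bound (by fun_prop) 1 (Eventually.of_forall fun x => Real.abs_cos_le_one _)
    have is : Integrable (fun x => Real.sin (inner ℝ ξ x)) α.toMeasure :=
      Integrable.of_bound (by fun_prop) 1 (Eventually.of_forall fun x => Real.abs_sin_le_one _)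
    rw [charFun_apply, ← integral_complex_ofReal, ← integral_complex_ofReal, ← integral_mul_const,
      ← integral_add ic.ofReal (is.ofReal.mul_const _)]
    refine integral_congr_ae (Eventually.of_forall fun x => ?_)
    simp only [real_inner_comm, Complex.exp_mul_I]
    push_cast
    rfl
  rw [key, key]
  simp only [Function.comp_def] at hcos hsin
  rw [hcos, hsin]

end SolvesContinuityEquation

/-! ### Truncated fields -/

section TruncatedField

variable {d : ℕ} {B : CompProb d → C(EuclideanSpace ℝ (Fin d), EuclideanSpace ℝ (Fin d))}
  {R : ℝ} {K M : NNReal}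

/-- The field `B[α]` precomposed with the retraction onto the ball of radius `R`. -/
noncomputable def truncatedField {d : ℕ}
    (B : CompProb d → C(EuclideanSpace ℝ (Fin d), EuclideanSpace ℝ (Fin d))) (R : ℝ)
    (α : CompProb d) (x : EuclideanSpace ℝ (Fin d)) : EuclideanSpace ℝ (Fin d) :=
  B α (ballRetract R x)

theorem ballRetract_mem_closedBall {V : Type*} [NormedAddCommGroup V] [NormedSpace ℝ V]
    (hR : 0 < R) (x : V) : ballRetract R x ∈ Metric.closedBall 0 R :=
  mem_closedBall_zero_iff.2 (norm_ballRetract_le hR x)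

theorem truncatedField_of_norm_le (hR : 0 < R) (α : CompProb d) {x : EuclideanSpace ℝ (Fin d)}
    (hx : ‖x‖ ≤ R) : truncatedField B R α x = B α x := by
  rw [truncatedField, ballRetract_of_norm_le hR hx]

theorem lipschitzWith_truncatedField (hR : 0 < R)
    (hK : ∀ α ∈ probBall d R, LipschitzOnWith K (B α) (Metric.closedBall 0 R)) {α : CompProb d}
    (hα : α ∈ probBall d R) : LipschitzWith (K * 2) (truncatedField B R α) :=
  lipschitzOnWith_univ.1 ((hK α hα).comp (lipschitzWith_ballRetract hR).lipschitzOnWith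
    fun x _ => ballRetract_mem_closedBall hR x)

/-- The retraction does not increase norms, so truncation keeps the growth constant `C`, and with it
the a priori radius. -/
theorem norm_truncatedField_le_mul_one_add {C : ℝ} (hC : 0 ≤ C) (H1 : LinearGrowth B C)
    (hR : 0 < R) (α : CompProb d) (x : EuclideanSpace ℝ (Fin d)) :
    ‖truncatedField B R α x‖ ≤ C * (1 + ‖x‖) :=
  (H1 α _).trans (by gcongr; exact norm_ballRetract_le_norm hR x)

theorem norm_truncatedField_le {C : ℝ} (hC : 0 ≤ C) (H1 : LinearGrowth B C)
    (hR : 0 < R) (α : CompProb d) (x : EuclideanSpace ℝ (Fin d)) :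
    ‖truncatedField B R α x‖ ≤ C * (1 + R) :=
  (H1 α _).trans (by gcongr; exact norm_ballRetract_le hR x)

theorem dist_truncatedField_le (hR : 0 < R)
    (hM : ∀ α₁ ∈ probBall d R, ∀ α₂ ∈ probBall d R,
      ∀ x ∈ Metric.closedBall (0 : EuclideanSpace ℝ (Fin d)) R,
        ‖B α₁ x - B α₂ x‖ ≤ M * W2 α₁ α₂) {α β : CompProb d} (hα : α ∈ probBall d R)
    (hβ : β ∈ probBall d R) (x : EuclideanSpace ℝ (Fin d)) :
    dist (truncatedField B R α x) (truncatedField B R β x) ≤ M * W2 α β := by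
  rw [dist_eq_norm]
  exact hM α hα β hβ _ (ballRetract_mem_closedBall hR x)

/-- Dependence on the measure is controlled uniformly in the point, so continuity in the point is
needed only at the fixed measure `α s₀`. -/
theorem continuous_truncatedField {S : Type*} [TopologicalSpace S] (hR : 0 < R)
    (hM : ∀ α₁ ∈ probBall d R, ∀ α₂ ∈ probBall d R,
      ∀ x ∈ Metric.closedBall (0 : EuclideanSpace ℝ (Fin d)) R,
        ‖B α₁ x - B α₂ x‖ ≤ M * W2 α₁ α₂) {α : S → CompProb d} (hα : ∀ s, α s ∈ probBall d R)
    (hc : ∀ s₀, Tendsto (fun s => W2 (α s) (α s₀)) (𝓝 s₀) (𝓝 0)) :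
    Continuous fun p : S × EuclideanSpace ℝ (Fin d) => truncatedField B R (α p.1) p.2 := by
  refine continuous_iff_continuousAt.2 fun ⟨s₀, x₀⟩ => ?_
  have h1 : Tendsto (fun p : S × EuclideanSpace ℝ (Fin d) => M * W2 (α p.1) (α s₀))
      (𝓝 (s₀, x₀)) (𝓝 0) := by
    simpa using ((hc s₀).comp (continuous_fst.tendsto (s₀, x₀))).const_mul (M : ℝ)
  have h2 : Tendsto (fun p : S × EuclideanSpace ℝ (Fin d) =>
      dist (truncatedField B R (α s₀) p.2) (truncatedField B R (α s₀) x₀))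
      (𝓝 (s₀, x₀)) (𝓝 0) := by
    have : Continuous fun p : S × EuclideanSpace ℝ (Fin d) =>
        dist (truncatedField B R (α s₀) p.2) (truncatedField B R (α s₀) x₀) :=
      (((B (α s₀)).continuous.comp (continuous_ballRetract hR)).comp continuous_snd).dist
        continuous_const
    simpa using this.tendsto (s₀, x₀)
  rw [ContinuousAt, tendsto_iff_dist_tendsto_zero]
  refine squeeze_zero (fun _ => dist_nonneg) (fun p => ?_) (by simpa using h1.add h2)
  exact (dist_triangle _ (truncatedField B R (α s₀) p.2) _).trans
    (add_le_add_left (dist_truncatedField_le hR hM (hα _) (hα _) _) _)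

end TruncatedField

/-! ### Flows in the space of bounded maps -/

section Flow

variable {d : ℕ} {T R : ℝ} {X X' : ℝ → EuclideanSpace ℝ (Fin d) →ᵇ EuclideanSpace ℝ (Fin d)}
  {b : ℝ → EuclideanSpace ℝ (Fin d) → EuclideanSpace ℝ (Fin d)}

theorem tendsto_W2_map (μ : CompProb d) {S : Type*} [TopologicalSpace S]
    {Y : S → EuclideanSpace ℝ (Fin d) →ᵇ EuclideanSpace ℝ (Fin d)} (hY : Continuous Y) (s₀ : S) :
    Tendsto (fun s => W2 (μ.map (Y s)) (μ.map (Y s₀))) (𝓝 s₀) (𝓝 0) :=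
  squeeze_zero (fun _ => W2_nonneg _ _) (fun s => W2_map_le_dist μ (Y s) (Y s₀))
    (tendsto_iff_dist_tendsto_zero.1 (hY.tendsto s₀))

/-- The points transported by a field of linear growth stay in an explicit ball. -/
theorem norm_flow_apply_le {C r : ℝ} (hC : 0 < C)
    (hX : ∀ t ∈ Icc 0 T, HasDerivWithinAt X (X' t) (Icc 0 T) t)
    (hX' : ∀ t ∈ Icc 0 T, ∀ x, ‖X' t x‖ ≤ C * (1 + ‖X t x‖)) (h0 : ∀ x, ‖X 0 x‖ ≤ r)
    {t : ℝ} (ht : t ∈ Icc 0 T) (x : EuclideanSpace ℝ (Fin d)) :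
    ‖X t x‖ ≤ (r + 1) * Real.exp (C * T) :=
  norm_le_of_norm_deriv_le_mul_one_add hC (y := fun t => X t x) (y' := fun t => X' t x)
    (fun t ht => by
      exact (BoundedContinuousFunction.evalCLM ℝ x).hasFDerivAt.comp_hasDerivWithinAt t (hX t ht))
    (fun t ht => hX' t ht x) (h0 x) t ht

theorem solvesContinuityEquation_of_flow (hT : 0 < T) (μ : CompProb d)
    (hb : Continuous fun p : ℝ × EuclideanSpace ℝ (Fin d) => b p.1 p.2)
    (hX : ∀ t ∈ Icc 0 T, HasDerivWithinAt X (X' t) (Icc 0 T) t)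
    (hX' : ∀ t ∈ Icc 0 T, ∀ x, X' t x = b t (X t x)) (hR : ∀ t ∈ Icc 0 T, ∀ x, ‖X t x‖ ≤ R) :
    SolvesContinuityEquation R T b fun t => μ.map (X (projIcc 0 T hT.le t)) where
  mem_probBall t := CompProb.map_mem_probBall
    (Eventually.of_forall (hR _ (projIcc 0 T hT.le t).2))
  tendsto_W2 := tendsto_W2_map μ (ContinuousOn.comp_continuous
    (fun t ht => (hX t ht).continuousWithinAt) (by fun_prop) fun t => (projIcc 0 T hT.le t).2)
  weak f hf := by
    have key := weak_formula_of_flow hT μ hb hX hX' hf.contDiffOn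
    rw [projIcc_right, projIcc_left]
    refine Eq.trans (intervalIntegral.integral_congr fun t ht => ?_) key
    rw [uIcc_of_le hT.le] at ht
    simp only [projIcc_of_mem hT.le ht]
    refine integral_congr_ae (Eventually.of_forall fun x => ?_)
    simp only
    rw [fderivWithin_eq_fderiv ((uniqueDiffOn_Icc hT).prod uniqueDiffOn_univ (t, x)
      ⟨ht, mem_univ _⟩) (hf.differentiable one_ne_zero _)]

end Flow

/-! ### The nonlinear equation as an ODE for transport maps -/

section Nonlinear

variable {d : ℕ} {B : CompProb d → C(EuclideanSpace ℝ (Fin d), EuclideanSpace ℝ (Fin d))}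
  {R T : ℝ} {K M : NNReal} {α₀ : CompProb d} {α : Icc (0 : ℝ) T → CompProb d}

/-- The solution is frozen inside its own field. Truncation is invisible because `α t` is supported
in the ball. -/
theorem IsWeakSolution.solvesContinuityEquation (hT : 0 < T) (hR : 0 < R)
    (h : IsWeakSolution B hT.le α₀ α) (hα : ∀ t, α t ∈ probBall d R) :
    SolvesContinuityEquation R T (fun t => truncatedField B R (α (projIcc 0 T hT.le t)))
      fun t => α (projIcc 0 T hT.le t) where
  mem_probBall t := hα _
  tendsto_W2 t₀ := (h.continuous _).comp (continuous_projIcc.tendsto t₀)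
  weak f hf := by
    have key := h.weak f hf.contDiffOn
    rw [projIcc_right, projIcc_left, h.initial]
    refine Eq.trans (intervalIntegral.integral_congr fun t ht => ?_) key
    rw [uIcc_of_le hT.le] at ht
    refine integral_congr_ae ?_
    filter_upwards [CompProb.mem_probBall_iff.1 (hα (projIcc 0 T hT.le t))] with x hx
    rw [derivWithin_add_inner_gradient hT (hf.differentiable one_ne_zero).differentiableOn ht,
      truncatedField_of_norm_le hR _ hx,
      fderivWithin_eq_fderiv ((uniqueDiffOn_Icc hT).prod uniqueDiffOn_univ (t, x)
        ⟨ht, mem_univ _⟩) (hf.differentiable one_ne_zero _)]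

/-- The retraction onto the ball of radius `R`, applied to the values of a bounded function. -/
noncomputable def retractValues (hR : 0 < R)
    (X : EuclideanSpace ℝ (Fin d) →ᵇ EuclideanSpace ℝ (Fin d)) :
    EuclideanSpace ℝ (Fin d) →ᵇ EuclideanSpace ℝ (Fin d) :=
  X.comp (ballRetract R) (lipschitzWith_ballRetract hR)

theorem map_retractValues_mem_probBall (hR : 0 < R) (α₀ : CompProb d)
    (X : EuclideanSpace ℝ (Fin d) →ᵇ EuclideanSpace ℝ (Fin d)) :
    α₀.map (retractValues hR X) ∈ probBall d R :=
  CompProb.map_mem_probBall (Eventually.of_forall fun x => norm_ballRetract_le hR (X x))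

/-- The vector field on the space of bounded maps whose integral curves transport `α₀` along the
nonlinear continuity equation. -/
noncomputable def lagrangianField (hR : 0 < R)
    (hK : ∀ α ∈ probBall d R, LipschitzOnWith K (B α) (Metric.closedBall 0 R)) (α₀ : CompProb d)
    (X : EuclideanSpace ℝ (Fin d) →ᵇ EuclideanSpace ℝ (Fin d)) :
    EuclideanSpace ℝ (Fin d) →ᵇ EuclideanSpace ℝ (Fin d) :=
  X.comp (truncatedField B R (α₀.map (retractValues hR X)))
    (lipschitzWith_truncatedField hR hK (map_retractValues_mem_probBall hR α₀ X))

theorem lagrangianField_apply (hR : 0 < R)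
    (hK : ∀ α ∈ probBall d R, LipschitzOnWith K (B α) (Metric.closedBall 0 R)) (α₀ : CompProb d)
    {X : EuclideanSpace ℝ (Fin d) →ᵇ EuclideanSpace ℝ (Fin d)} (hX : ∀ x, ‖X x‖ ≤ R)
    (x : EuclideanSpace ℝ (Fin d)) :
    lagrangianField hR hK α₀ X x = truncatedField B R (α₀.map X) (X x) := by
  have : retractValues hR X = X :=
    BoundedContinuousFunction.ext fun x => ballRetract_of_norm_le hR (hX x)
  change truncatedField B R (α₀.map (retractValues hR X)) (X x) = _
  rw [this]

/-- Moving the evaluation point costs `K * 2` by (H2); moving the measure costs `M * 2` by (H3) and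
`W2_map_le_dist`. Each 2 comes from a retraction. -/
theorem lipschitzWith_lagrangianField (hR : 0 < R)
    (hK : ∀ α ∈ probBall d R, LipschitzOnWith K (B α) (Metric.closedBall 0 R))
    (hM : ∀ α₁ ∈ probBall d R, ∀ α₂ ∈ probBall d R,
      ∀ x ∈ Metric.closedBall (0 : EuclideanSpace ℝ (Fin d)) R,
        ‖B α₁ x - B α₂ x‖ ≤ M * W2 α₁ α₂) (α₀ : CompProb d) :
    LipschitzWith (K * 2 + M * 2) (lagrangianField hR hK α₀) := by
  refine LipschitzWith.of_dist_le_mul fun X Y => ?_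
  refine (BoundedContinuousFunction.dist_le (by positivity)).2 fun x => ?_
  have hX := map_retractValues_mem_probBall hR α₀ X
  have hY := map_retractValues_mem_probBall hR α₀ Y
  have h1 := (lipschitzWith_truncatedField hR hK hX).dist_le_mul (X x) (Y x)
  have h2 := dist_truncatedField_le hR hM hX hY (Y x)
  have h3 := W2_map_le_dist α₀ (retractValues hR X) (retractValues hR Y)
  have h4 : dist (retractValues hR X) (retractValues hR Y) ≤ (2 : NNReal) * dist X Y :=
    (BoundedContinuousFunction.lipschitz_comp (lipschitzWith_ballRetract hR)).dist_le_mul X Y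
  have h5 := BoundedContinuousFunction.dist_coe_le_dist (f := X) (g := Y) x
  refine (dist_triangle _ (truncatedField B R (α₀.map (retractValues hR X)) (Y x)) _).trans ?_
  calc _ ≤ ((K * 2 : NNReal) : ℝ) * dist X Y + M * ((2 : NNReal) * dist X Y) := by
        refine add_le_add (h1.trans ?_) (h2.trans ?_)
        · gcongr
        · gcongr
          exact h3.trans h4
    _ = _ := by push_cast; ring

end Nonlinear

/-! ### Existence and uniqueness -/

theorem lemma3p1 (d : ℕ)
    (B : CompProb d → C(EuclideanSpace ℝ (Fin d), EuclideanSpace ℝ (Fin d)))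
    (C : ℝ) (hC : 0 < C) (H1 : LinearGrowth B C)
    (H2 : LipschitzInSpace B) (H3 : LipschitzInMeasure B)
    (R₀ : ℝ) (hR₀ : 0 < R₀) (α₀ : CompProb d) (hα₀ : α₀ ∈ probBall d R₀)
    (T : ℝ) (hT : 0 < T) :
    ∃! α : Icc (0 : ℝ) T → CompProb d,
      (∀ t, α t ∈ probBall d ((R₀ + 1) * Real.exp (C * T))) ∧
        IsWeakSolution B hT.le α₀ α := by
  set R := (R₀ + 1) * Real.exp (C * T)
  have hR : 0 < R := by positivity
  obtain ⟨K, hK⟩ := H2 R hR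
  obtain ⟨M', hM'⟩ := H3 R hR
  let M : NNReal := Real.toNNReal M'
  have hM : ∀ α₁ ∈ probBall d R, ∀ α₂ ∈ probBall d R,
      ∀ x ∈ Metric.closedBall (0 : EuclideanSpace ℝ (Fin d)) R,
        ‖B α₁ x - B α₂ x‖ ≤ M * W2 α₁ α₂ := fun α₁ h₁ α₂ h₂ x hx =>
    (hM' α₁ h₁ α₂ h₂ x hx).trans
      (mul_le_mul_of_nonneg_right (Real.le_coe_toNNReal M') (W2_nonneg _ _))
  let L : NNReal := ⟨C * (1 + R), by positivity⟩
  -- The identity is not bounded; this replacement agrees with it `α₀`-almost everywhere.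
  let X₀ : EuclideanSpace ℝ (Fin d) →ᵇ EuclideanSpace ℝ (Fin d) :=
    BoundedContinuousFunction.ofNormedAddCommGroup (ballRetract R₀) (continuous_ballRetract hR₀)
      R₀ (norm_ballRetract_le hR₀)
  have hX₀ : ∀ x, ‖X₀ x‖ ≤ R₀ := norm_ballRetract_le hR₀
  have hmapX₀ : α₀.map X₀ = α₀ := CompProb.map_eq_self
    ((CompProb.mem_probBall_iff.1 hα₀).mono fun x hx => ballRetract_of_norm_le hR₀ hx)
  have hnorm : ∀ (g : EuclideanSpace ℝ (Fin d) →ᵇ EuclideanSpace ℝ (Fin d)),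
      (∀ x, ‖g x‖ ≤ L) → ‖g‖ ≤ L := fun g hg =>
    (BoundedContinuousFunction.norm_le L.2).2 hg
  have hlip := lipschitzWith_lagrangianField hR hK hM α₀
  obtain ⟨X, hX0, hX⟩ := exists_hasDerivWithinAt_Icc_of_lipschitzWith hT.le
    (F := fun _ => lagrangianField hR hK α₀) (L := L) (fun _ => hlip)
    (fun _ => continuous_const)
    (fun _ Y => hnorm _ fun x => norm_truncatedField_le hC.le H1 hR _ _) X₀
  -- The a priori bound holds for the truncated dynamics and lands exactly in `B_R`, so the
  -- retractions act trivially along `X`.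
  have hXR : ∀ t ∈ Icc 0 T, ∀ x, ‖X t x‖ ≤ R := fun t ht x =>
    norm_flow_apply_le hC hX
      (fun t _ x => norm_truncatedField_le_mul_one_add hC.le H1 hR _ _)
      (fun x => by rw [hX0]; exact hX₀ x) ht x
  have hXball : ∀ t : Icc (0 : ℝ) T, α₀.map (X t) ∈ probBall d R := fun t =>
    CompProb.map_mem_probBall (Eventually.of_forall (hXR t t.2))
  have hXW : W2Continuous fun t : Icc (0 : ℝ) T => α₀.map (X t) :=
    tendsto_W2_map α₀ (ContinuousOn.comp_continuous
      (fun t ht => (hX t ht).continuousWithinAt) continuous_subtype_val fun t => t.2)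
  have hcurve : ∀ {α : Icc (0 : ℝ) T → CompProb d}, (∀ t, α t ∈ probBall d R) →
      W2Continuous α → Continuous fun p : ℝ × EuclideanSpace ℝ (Fin d) =>
        truncatedField B R (α (projIcc 0 T hT.le p.1)) p.2 := fun hα hc =>
    continuous_truncatedField hR hM (α := fun t => _) (fun t => hα _)
      fun t₀ => (hc _).comp (continuous_projIcc.tendsto t₀)
  refine ⟨fun t => α₀.map (X t), ⟨hXball, hXW, ?_, fun f hf => ?_⟩, fun α ⟨hα, hsol⟩ => ?_⟩
  · simp only [hX0, hmapX₀]
  · have key := weak_formula_of_flow hT α₀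
      (b := fun t => truncatedField B R (α₀.map (X (projIcc 0 T hT.le t))))
      (hcurve hXball hXW) hX (fun t ht x => by
      simp only [projIcc_of_mem hT.le ht]
      exact lagrangianField_apply hR hK α₀ (hXR t ht) x) hf
    rw [hX0, hmapX₀] at key
    refine Eq.trans (intervalIntegral.integral_congr fun t ht => ?_) key
    rw [uIcc_of_le hT.le] at ht
    simp only [projIcc_of_mem hT.le ht]
    refine integral_congr_ae ?_
    filter_upwards [CompProb.mem_probBall_iff.1 (hXball ⟨t, ht⟩)] with x hx
    rw [derivWithin_add_inner_gradient hT (hf.differentiableOn one_ne_zero) ht,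
      truncatedField_of_norm_le hR _ hx]
  · set b : ℝ → EuclideanSpace ℝ (Fin d) → EuclideanSpace ℝ (Fin d) := fun t =>
      truncatedField B R (α (projIcc 0 T hT.le t))
    have hb : Continuous fun p : ℝ × EuclideanSpace ℝ (Fin d) => b p.1 p.2 :=
      hcurve hα hsol.continuous
    have hbK : ∀ t, LipschitzWith (K * 2) (b t) := fun t =>
      lipschitzWith_truncatedField hR hK (hα _)
    have hWp : ∀ t₀, Tendsto (fun t => M * W2 (α (projIcc 0 T hT.le t))
        (α (projIcc 0 T hT.le t₀))) (𝓝 t₀) (𝓝 0) := fun t₀ => by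
      simpa using ((hsol.continuous _).comp (continuous_projIcc.tendsto t₀)).const_mul (M : ℝ)
    let F : ℝ → (EuclideanSpace ℝ (Fin d) →ᵇ EuclideanSpace ℝ (Fin d)) →
        (EuclideanSpace ℝ (Fin d) →ᵇ EuclideanSpace ℝ (Fin d)) := fun t =>
      BoundedContinuousFunction.comp (b t) (hbK t)
    have hFlip : ∀ t, LipschitzWith (K * 2) (F t) := fun t =>
      BoundedContinuousFunction.lipschitz_comp (hbK t)
    have hFcont : ∀ Z, Continuous fun t => F t Z := fun Z =>
      continuous_iff_continuousAt.2 fun t₀ => by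
        rw [ContinuousAt, tendsto_iff_dist_tendsto_zero]
        refine squeeze_zero (fun _ => dist_nonneg) (fun t => ?_) (hWp t₀)
        exact (BoundedContinuousFunction.dist_le (mul_nonneg M.2 (W2_nonneg _ _))).2 fun x =>
          dist_truncatedField_le hR hM (hα _) (hα _) _
    have hFL : ∀ t Z, ‖F t Z‖ ≤ L := fun t Z =>
      hnorm _ fun x => norm_truncatedField_le hC.le H1 hR _ _
    obtain ⟨Y, hY0, hY⟩ :=
      exists_hasDerivWithinAt_Icc_of_lipschitzWith hT.le hFlip hFcont hFL X₀
    have hYR : ∀ t ∈ Icc 0 T, ∀ x, ‖Y t x‖ ≤ R := fun t ht x =>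
      norm_flow_apply_le hC hY
        (fun t _ x => norm_truncatedField_le_mul_one_add hC.le H1 hR _ _)
        (fun x => by rw [hY0]; exact hX₀ x) ht x
    -- Both curves solve the linear equation with field `b` and start at `α₀`.
    have hYα : ∀ t (ht : t ∈ Icc 0 T), α ⟨t, ht⟩ = α₀.map (Y t) := fun t ht => by
      have hflow : SolvesContinuityEquation R T b fun t => α₀.map (Y (projIcc 0 T hT.le t)) :=
        solvesContinuityEquation_of_flow hT α₀ hb hY (fun _ _ _ => rfl) hYR
      have hlin : SolvesContinuityEquation R T b fun t => α (projIcc 0 T hT.le t) :=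
        hsol.solvesContinuityEquation hT hR hα
      have := hlin.eq_of_zero_eq hflow hT hb hbK (M := C * (1 + R))
        (fun t x => norm_truncatedField_le hC.le H1 hR _ x)
        (by rw [projIcc_left, hsol.initial, hY0, hmapX₀]) ht
      simpa only [projIcc_of_mem hT.le ht] using this
    -- Since `α_t = Y_t#α₀`, the frozen field along `Y` is the Lagrangian field at `Y`, so both
    -- curves solve one autonomous ODE.
    have hYX : EqOn Y X (Icc 0 T) := by
      refine eqOn_Icc_of_hasDerivWithinAt_of_lipschitzWith
        (F := fun _ => lagrangianField hR hK α₀) (fun _ => hlip) (fun t ht => ?_) hX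
        (hY0.trans hX0.symm)
      convert! hY t ht using 1
      ext1 x
      rw [lagrangianField_apply hR hK α₀ (hYR t ht), ← hYα t ht, ← projIcc_of_mem hT.le ht]
      rfl
    funext t
    rw [hYα t t.2, hYX t.2]
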